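/- **Conventions.** An $\Omega$-spectrum $F=(F_n)_{n\in\mathbb Z}$ is a family of pointed spaces with pointed homotopy equivalences $F_n\simeq\Omega F_{n+1}$. It defines the abelian groups $h^n(X,Y)=[(X,Y),(F_n,*)]$ (homotopy classes of maps $X\to F_n$ sending $Y$ to the basepoint; addition is concatenation of loops via $F_n\simeq\Omega F_{n+1}$). For a discrete group $G$, a *model of $EG$* is a contractible space $E$ on which $G$ acts by homeomorphisms such that $E\to E/G$ is a numerable principal $G$-bundle (one admitting a countable trivializing partition of unity on $E/G$; this holds for the universal cover of any CW model of $BG$); $E/G$ is then a model of $BG$. Write $E\times_G X=(E\times X)/G$ and $h^n_G(X,Y)=h^n(EG\times_G X,EG\times_G Y)$. For a homomorphism $\phi:G\to\{\pm1\}$ let $\tilde I=[0,1]$ with action $g.x=\tfrac12+\phi(g)(x-\tfrac12)$, and put $h^{\phi+n}_G(X,Y)=h^{n+1}_G(X\times\tilde I,\;Y\times\tilde I\cup X\times\partial\tilde I)$ and $h^{\phi+n}_G(X)=h^{\phi+n}_G(X,\emptyset)$. A *classification of SPT phases* assigns to each dimension $d\ge0$ a contravariant functor $(G,\phi)\mapsto\mathcal{SPT}^d(G,\phi)$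 to abelian groups, on pairs of a discrete group $G$ and a homomorphism $\phi:G\to\{\pm1\}$, a morphism $(G_1,\phi_1)\to(G_2,\phi_2)$ being a homomorphism $f:G_1\to G_2$ with $\phi_2\circ f=\phi_1$. It satisfies the *generalized cohomology hypothesis* for $F$ if there are isomorphisms of abelian groups $\mathcal{SPT}^d(G,\phi)\cong h^{\phi+d}_G(\mathrm{pt})$ for all $d,G,\phi$, natural in $(G,\phi)$ (for any choice of models of $EG$). **Statement.** Let $G\subset\mathbb R^d\rtimes O(d)$ be a space group, i.e. a discrete group of isometries of $\mathbb R^d$ with compact fundamental domain, let $\Pi\subset G$ be its subgroup of pure translations, $P\subset O(d)$ its point group, and $\pi:G\to P$ the projection. Let $\phi_{\rm int}:G\to\{\pm1\}$ be a homomorphism (recording which elements act antiunitarily) with $\phi_{\rm int}(v)=1$ for all $v\in\Pi$, and let $\phi=\phi_{\rm int}\phi_{\rm spa}$, where $\phi_{\rm spa}(g)=-1$ exactly when $g$ reverses the orientation of $\mathbb R^d$. Then $\phi$ is trivial on $\Pi$; denote also by $\phi$ the induced homomorphism $P\to\{\pm1\}$. Put $B\Pi=\mathbb R^d/\Pi$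 with the $P$-action $p.[v]=[a(p)+pv]$, where $a(p)\in\mathbb R^d$ is any vector with $(a(p),p)\in G$. Let $EG$ and $EP$ be any models for $G$ and $P$. 1. $E\Pi=\mathbb R^d$ is a model of $E\Pi$. The space $E\Pi\times EP$, with $G$ acting on $E\Pi=\mathbb R^d$ by isometries and on $EP$ through $\pi$, is a model of $EG$. The map $[(v,x)]\mapsto[([v],x)]$ is a well-defined homeomorphism $E\Pi\times_G EP\cong B\Pi\times_P EP$. The space $BG=EG/G$ is homotopy equivalent to $B\Pi\times_P EP$. 2. For every $\Omega$-spectrum and every $n\in\mathbb Z$ there are isomorphisms of abelian groups $$h^{\phi+n}_G(\mathrm{pt})\cong h^{\phi+n}_P(B\Pi),\qquad h^{\phi+n}_G(\mathrm{pt})\cong h^{\phi+n}_G(\mathbb R^d),$$ where the groups for $G$ are computed from $EG$ and the one for $P$ from $EP$. 3. Consequently, for every classification of SPT phases that satisfies the generalized cohomology hypothesis for the spectrum defining $h$, $$\mathcal{SPT}^d(G,\phi)\;\cong\;h^{\phi+d}_G(\mathrm{pt})\;\cong\;h^{\phi+d}_P(B\Pi)\;\cong\;h^{\phi+d}_G(\mathbb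 R^d).$$ -/

import Mathlib

universe u v w

open scoped unitInterval

noncomputable section

/-! ### Homotopy classes of maps of pairs -/

/-- Maps of pairs `(X, Y) → (Z, z)`: continuous maps `X → Z` sending all of `Y` to `z`. -/
def PairMap (X : Type*) [TopologicalSpace X] (Y : Set X) (Z : Type*) [TopologicalSpace Z] (z : Z) :=
  {f : C(X, Z) // ∀ y ∈ Y, f y = z}

/-- Homotopy through maps of pairs `(X, Y) → (Z, z)`: since both maps are constant on `Y`,
this is homotopy relative to `Y`. -/
instance PairMap.setoid (X : Type*) [TopologicalSpace X] (Y : Set X)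
    (Z : Type*) [TopologicalSpace Z] (z : Z) : Setoid (PairMap X Y Z z) where
  r f g := f.1.HomotopicRel g.1 Y
  iseqv := ⟨fun f => .refl f.1, fun h => h.symm, fun h k => h.trans k⟩

/-- The set `[(X, Y), (Z, z)]` of homotopy classes of maps of pairs. -/
def PairClass (X : Type*) [TopologicalSpace X] (Y : Set X)
    (Z : Type*) [TopologicalSpace Z] (z : Z) :=
  Quotient (PairMap.setoid X Y Z z)

namespace PairClass

variable {X : Type*} [TopologicalSpace X] {Y : Set X}
variable {X' : Type*} [TopologicalSpace X'] {Y' : Set X'}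
variable {Z : Type*} [TopologicalSpace Z] {z : Z}
variable {W : Type*} [TopologicalSpace W] {w : W}

theorem homotopicRel_of {f g : PairMap X Y Z z} (H : I × X → Z) (hc : Continuous H)
    (h0 : ∀ x, H (0, x) = f.1 x) (h1 : ∀ x, H (1, x) = g.1 x)
    (hY : ∀ t, ∀ y ∈ Y, H (t, y) = z) : f.1.HomotopicRel g.1 Y :=
  ⟨{ toFun := H
     continuous_toFun := hc
     map_zero_left := h0
     map_one_left := h1
     prop' := fun t y hy => (hY t y hy).trans (f.2 y hy).symm }⟩

/-- The map on classes induced by a map of pairs `(X, Y) → (X', Y')`. -/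
def pull (Z : Type*) [TopologicalSpace Z] (z : Z) (k : C(X, X')) (hk : ∀ y ∈ Y, k y ∈ Y') :
    PairClass X' Y' Z z → PairClass X Y Z z :=
  Quotient.map (fun f => ⟨f.1.comp k, fun y hy => f.2 _ (hk y hy)⟩) (by
    rintro f g ⟨H⟩
    refine homotopicRel_of (fun p => H (p.1, k p.2)) (by fun_prop) (by simp) (by simp) ?_
    intro t y hy
    exact (H.prop' t _ (hk y hy)).trans (f.2 _ (hk y hy)))

/-- The map on classes induced by a pointed map `(Z, z) → (W, w)`. -/
def push (X : Type*) [TopologicalSpace X] (Y : Set X) (k : C(Z, W)) (hk : k z = w) :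
    PairClass X Y Z z → PairClass X Y W w :=
  Quotient.map (fun f => ⟨k.comp f.1, fun y hy => by simp [f.2 y hy, hk]⟩)
    (fun _ _ h => h.comp_continuousMap k)

theorem push_comp_eq {k : C(Z, W)} {l : C(W, Z)} (hk : k z = w) (hl : l w = z)
    (h : (l.comp k).HomotopicRel (ContinuousMap.id Z) {z}) (a : PairClass X Y Z z) :
    push X Y l hl (push X Y k hk a) = a := by
  induction a using Quotient.inductionOn with
  | h f =>
    obtain ⟨H⟩ := h
    refine Quotient.sound (homotopicRel_of (fun p => H (p.1, f.1 p.2)) (by fun_prop)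
      (by simp) (by simp) ?_)
    intro t y hy
    have := H.prop' t z rfl
    simp only [f.2 y hy]
    exact this.trans (by simp [hk, hl])

/-- A pointed homotopy equivalence induces a bijection on classes. -/
def pushEquiv (X : Type*) [TopologicalSpace X] (Y : Set X)
    (k : C(Z, W)) (l : C(W, Z)) (hk : k z = w) (hl : l w = z)
    (h₁ : (l.comp k).HomotopicRel (ContinuousMap.id Z) {z})
    (h₂ : (k.comp l).HomotopicRel (ContinuousMap.id W) {w}) :
    PairClass X Y Z z ≃ PairClass X Y W w where
  toFun := push X Y k hk
  invFun := push X Y l hl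
  left_inv := push_comp_eq hk hl h₁
  right_inv := push_comp_eq hl hk h₂

/-! #### Concatenation of loops -/

/-- Pointwise concatenation of maps into a loop space. -/
def concat : PairClass X Y (Path z z) (Path.refl z) → PairClass X Y (Path z z) (Path.refl z) →
    PairClass X Y (Path z z) (Path.refl z) :=
  Quotient.map₂ (fun f g => ⟨⟨fun x => (f.1 x).trans (g.1 x), by fun_prop⟩, fun y hy => by
      simp [f.2 y hy, g.2 y hy]⟩) (by
    rintro f f' ⟨H⟩ g g' ⟨K⟩
    refine homotopicRel_of (fun p => (H p).trans (K p)) (by fun_prop) (by simp) (by simp) ?_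
    intro t y hy
    have h1 : H (t, y) = Path.refl z := (H.prop' t y hy).trans (f.2 y hy)
    have h2 : K (t, y) = Path.refl z := (K.prop' t y hy).trans (g.2 y hy)
    simp [h1, h2])

/-- The class of the constant map. -/
def const : PairClass X Y Z z := Quotient.mk _ ⟨ContinuousMap.const X z, fun _ _ => rfl⟩

/-- Pointwise reversal of loops. -/
def rev : PairClass X Y (Path z z) (Path.refl z) → PairClass X Y (Path z z) (Path.refl z) :=
  push X Y ⟨Path.symm, Path.continuous_symm⟩ (by simp)

theorem continuous_path_iff {A : Type*} [TopologicalSpace A] {g : A → Path z z} :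
    Continuous g ↔ Continuous fun p : A × I => g p.1 p.2 :=
  Path.continuous_uncurry_iff.symm

/-- The segment from `ρ s` to `s` in the unit interval. -/
def slide (ρ : C(I, I)) (t s : I) : I :=
  ⟨(1 - (t : ℝ)) * ρ s + t * s, by
    have h1 := (ρ s).2; have h2 := s.2; have h3 := t.2
    simp only [Set.mem_Icc] at *
    constructor
    · have : 0 ≤ (1 - (t:ℝ)) * ρ s := mul_nonneg (by linarith) (by linarith)
      have : 0 ≤ (t:ℝ) * s := mul_nonneg (by linarith) (by linarith)
      linarith
    · nlinarith⟩

theorem continuous_slide (ρ : C(I, I)) : Continuous fun p : I × I => slide ρ p.1 p.2 := by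
  unfold slide
  fun_prop

/-- Reparametrizing all loops does not change the class. -/
theorem reparam_eq (ρ : C(I, I)) (h0 : ρ 0 = 0) (h1 : ρ 1 = 1)
    (f g : PairMap X Y (Path z z) (Path.refl z)) (h : ∀ x s, g.1 x s = f.1 x (ρ s)) :
    Quotient.mk (PairMap.setoid X Y (Path z z) (Path.refl z)) g = Quotient.mk _ f := by
  refine Quotient.sound (homotopicRel_of (fun p =>
    { toFun := fun s => f.1 p.2 (slide ρ p.1 s)
      continuous_toFun := ?_
      source' := ?_
      target' := ?_ }) ?_ ?_ ?_ ?_)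
  · exact (f.1 p.2).continuous.comp ((continuous_slide ρ).comp (by fun_prop : Continuous fun s => (p.1, s)))
  · have : slide ρ p.1 0 = 0 := by ext; simp [slide, h0]
    simp [this]
  · have : slide ρ p.1 1 = 1 := by ext; simp [slide, h1]
    simp [this]
  · rw [continuous_path_iff]
    have := continuous_slide ρ
    have h2 : Continuous fun q : (I × X) × I => slide ρ q.1.1 q.2 :=
      this.comp (by fun_prop : Continuous fun q : (I × X) × I => (q.1.1, q.2))
    have h3 : Continuous fun q : X × I => f.1 q.1 q.2 := continuous_path_iff.1 f.1.continuous
    exact h3.comp (by fun_prop : Continuous fun q : (I × X) × I => (q.1.2, slide ρ q.1.1 q.2))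
  · intro x
    ext s
    have : slide ρ 0 s = ρ s := by ext; simp [slide]
    simp [this, h]
  · intro x
    ext s
    have : slide ρ 1 s = s := by ext; simp [slide]
    simp [this]
  · intro t y hy
    ext s
    simp [f.2 y hy]

open Path.Homotopy in
theorem concat_assoc (a b c : PairClass X Y (Path z z) (Path.refl z)) :
    concat (concat a b) c = concat a (concat b c) := by
  induction a using Quotient.inductionOn with
  | h f =>
  induction b using Quotient.inductionOn with
  | h g =>
  induction c using Quotient.inductionOn with
  | h k =>
  refine reparam_eq ⟨fun t => ⟨transAssocReparamAux t, transAssocReparamAux_mem_I t⟩, by fun_prop⟩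
    (Subtype.ext transAssocReparamAux_zero) (Subtype.ext transAssocReparamAux_one) _ _ ?_
  intro x s
  exact congrArg (fun p : Path z z => p s) (trans_assoc_reparam (f.1 x) (g.1 x) (k.1 x))

open Path.Homotopy in
theorem concat_const (a : PairClass X Y (Path z z) (Path.refl z)) : concat a const = a := by
  induction a using Quotient.inductionOn with
  | h f =>
  refine reparam_eq ⟨fun t => ⟨transReflReparamAux t, transReflReparamAux_mem_I t⟩, by fun_prop⟩
    (Subtype.ext transReflReparamAux_zero) (Subtype.ext transReflReparamAux_one) _ _ ?_
  intro x s
  exact congrArg (fun p : Path z z => p s) (trans_refl_reparam (f.1 x))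

/-- The tent function, going from `0` up to `1` and back. -/
def tent (s : I) : I :=
  ⟨1 - |2 * (s : ℝ) - 1|, by
    have h2 := s.2
    simp only [Set.mem_Icc] at h2
    have : |2 * (s : ℝ) - 1| ≤ 1 := abs_le.2 ⟨by linarith, by linarith⟩
    exact ⟨by linarith, by linarith [abs_nonneg (2 * (s : ℝ) - 1)]⟩⟩

theorem concat_rev (a : PairClass X Y (Path z z) (Path.refl z)) : concat a (rev a) = const := by
  induction a using Quotient.inductionOn with
  | h f =>
  symm
  have htent : Continuous tent := by unfold tent; fun_prop
  have hf : Continuous fun q : X × I => f.1 q.1 q.2 := continuous_path_iff.1 f.1.continuous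
  have t0 : tent 0 = 0 := by ext; simp [tent]
  have t1 : tent 1 = 0 := by ext; norm_num [tent]
  refine Quotient.sound (homotopicRel_of (fun p =>
    { toFun := fun s => f.1 p.2 (p.1 * tent s)
      continuous_toFun := by fun_prop
      source' := by simp [t0]
      target' := by simp [t1] }) ?_ ?_ ?_ ?_)
  · rw [continuous_path_iff]
    exact hf.comp (by fun_prop : Continuous fun q : (I × X) × I => (q.1.2, q.1.1 * tent q.2))
  · intro x
    ext s
    simp
  · intro x
    ext s
    change f.1 x (1 * tent s) = (f.1 x).trans (f.1 x).symm s
    rw [Path.trans_apply, one_mul]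
    split_ifs with h
    · congr 1
      ext
      simp only [tent]
      rw [abs_of_nonpos (by linarith)]
      ring
    · rw [Path.symm_apply]
      congr 1
      ext
      simp only [tent, unitInterval.coe_symm_eq]
      rw [abs_of_nonneg (by linarith)]
  · intro t y hy
    ext s
    simp [f.2 y hy]

/-- Concatenation makes the classes of maps into a loop space a group. -/
abbrev loopGroup (X : Type*) [TopologicalSpace X] (Y : Set X)
    {Z : Type*} [TopologicalSpace Z] (z : Z) : Group (PairClass X Y (Path z z) (Path.refl z)) :=
  letI : Mul (PairClass X Y (Path z z) (Path.refl z)) := ⟨concat⟩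
  letI : Inv (PairClass X Y (Path z z) (Path.refl z)) := ⟨rev⟩
  letI : One (PairClass X Y (Path z z) (Path.refl z)) := ⟨const⟩
  Group.ofRightAxioms concat_assoc concat_const concat_rev

theorem const_concat (a : PairClass X Y (Path z z) (Path.refl z)) : concat const a = a :=
  letI := loopGroup X Y z
  one_mul a

/-- Exchanging the two coordinates of a double loop. -/
def swapLoop (z : Z) : C(Path (Path.refl z) (Path.refl z), Path (Path.refl z) (Path.refl z)) where
  toFun p :=
    { toFun := fun s =>
        { toFun := fun t => p t s
          continuous_toFun := by fun_prop
          source' := by simp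
          target' := by simp }
      continuous_toFun := by
        rw [continuous_path_iff]
        exact (continuous_path_iff.1 p.continuous).comp continuous_swap
      source' := by ext t; simp
      target' := by ext t; simp }
  continuous_toFun := by
    rw [continuous_path_iff, continuous_path_iff]
    have h : Continuous fun q : (Path (Path.refl z) (Path.refl z) × I) × I => q.1.1 q.1.2 q.2 :=
      continuous_path_iff.1 (by fun_prop :
        Continuous fun q : Path (Path.refl z) (Path.refl z) × I => q.1 q.2)
    exact h.comp (by fun_prop : Continuous
      fun q : (Path (Path.refl z) (Path.refl z) × I) × I => ((q.1.1, q.2), q.1.2))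

/-- The involution on classes of maps into a double loop space given by exchanging coordinates. -/
def swap : PairClass X Y (Path (Path.refl z) (Path.refl z)) (Path.refl (Path.refl z)) →
    PairClass X Y (Path (Path.refl z) (Path.refl z)) (Path.refl (Path.refl z)) :=
  push X Y (swapLoop z) rfl

theorem swap_swap (a : PairClass X Y (Path (Path.refl z) (Path.refl z))
    (Path.refl (Path.refl z))) : swap (swap a) = a := by
  induction a using Quotient.inductionOn with
  | h f => rfl

/-- Concatenation of double loops is commutative on classes. -/
theorem concat_comm (a b : PairClass X Y (Path (Path.refl z) (Path.refl z))
    (Path.refl (Path.refl z))) : concat a b = concat b a := by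
  have hc : swap (const : PairClass X Y (Path (Path.refl z) (Path.refl z))
    (Path.refl (Path.refl z))) = const := rfl
  have h₂ : EckmannHilton.IsUnital
      (concat : PairClass X Y (Path (Path.refl z) (Path.refl z)) (Path.refl (Path.refl z)) → _ → _)
      const :=
    { left_id := const_concat
      right_id := concat_const }
  have h₁ : EckmannHilton.IsUnital
      (fun a b : PairClass X Y (Path (Path.refl z) (Path.refl z)) (Path.refl (Path.refl z)) =>
        swap (concat (swap a) (swap b))) const :=
    { left_id := fun a => by simp only [hc, const_concat, swap_swap]
      right_id := fun a => by simp only [hc, concat_const, swap_swap] }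
  refine (EckmannHilton.mul_comm h₁ h₂ ?_).comm a b
  intro a b c d
  induction a using Quotient.inductionOn with
  | h f =>
  induction b using Quotient.inductionOn with
  | h g =>
  induction c using Quotient.inductionOn with
  | h k =>
  induction d using Quotient.inductionOn with
  | h l =>
  refine congrArg (Quotient.mk _) (Subtype.ext (ContinuousMap.ext fun x => ?_))
  ext s t
  change ((swapLoop z ((f.1 x).trans (g.1 x))).trans (swapLoop z ((k.1 x).trans (l.1 x)))) t s =
    ((swapLoop z ((swapLoop z (f.1 x)).trans (swapLoop z (k.1 x)))).trans
      (swapLoop z ((swapLoop z (g.1 x)).trans (swapLoop z (l.1 x))))) s t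
  simp only [Path.trans_apply]
  split_ifs with h1 h2 h2
  all_goals
    simp only [swapLoop, ContinuousMap.coe_mk, Path.coe_mk_mk, Path.trans_apply, h1, h2, dite_true,
      dite_false]
    try rfl

/-- The map of loop spaces induced by a pointed map. -/
def loopMap (k : C(Z, W)) (hk : k z = w) : C(Path z z, Path w w) where
  toFun p := (p.map k.continuous).cast hk.symm hk.symm
  continuous_toFun := by
    rw [continuous_path_iff]
    exact k.continuous.comp (by fun_prop : Continuous fun q : Path z z × I => q.1 q.2)

theorem loopMap_refl (k : C(Z, W)) (hk : k z = w) :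
    loopMap k hk (Path.refl z) = Path.refl w := by
  ext t
  exact hk

theorem loopMap_comp_homotopicRel {k : C(Z, W)} {l : C(W, Z)} (hk : k z = w) (hl : l w = z)
    (h : (l.comp k).HomotopicRel (ContinuousMap.id Z) {z}) :
    ((loopMap l hl).comp (loopMap k hk)).HomotopicRel (ContinuousMap.id _) {Path.refl z} := by
  obtain ⟨H⟩ := h
  have hz : ∀ t, H (t, z) = z := fun t => (H.prop' t z rfl).trans (by simp [hk, hl])
  have key := homotopicRel_of (X := Path z z) (Y := {Path.refl z}) (Z := Path z z)
    (z := Path.refl z)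
    (f := ⟨(loopMap l hl).comp (loopMap k hk), by
      rintro _ rfl; simp [loopMap_refl]⟩)
    (g := ⟨ContinuousMap.id _, by rintro _ rfl; rfl⟩)
    (fun p =>
      { toFun := fun s => H (p.1, p.2 s)
        continuous_toFun := by fun_prop
        source' := by simp [hz]
        target' := by simp [hz] })
    (by
      rw [continuous_path_iff]
      change Continuous fun q : (I × Path z z) × I => H (q.1.1, q.1.2 q.2)
      fun_prop)
    (by intro p; ext s; simp [loopMap])
    (by intro p; ext s; simp)
    (by rintro t _ rfl; ext s; simp [hz])
  exact key

theorem push_loopMap_concat (k : C(Z, W)) (hk : k z = w)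
    (a b : PairClass X Y (Path z z) (Path.refl z)) :
    push X Y (loopMap k hk) (loopMap_refl k hk) (concat a b) =
      concat (push X Y (loopMap k hk) (loopMap_refl k hk) a)
        (push X Y (loopMap k hk) (loopMap_refl k hk) b) := by
  induction a using Quotient.inductionOn with
  | h f =>
  induction b using Quotient.inductionOn with
  | h g =>
  refine congrArg (Quotient.mk _) (Subtype.ext (ContinuousMap.ext fun x => ?_))
  ext s
  change k ((f.1 x).trans (g.1 x) s) = (Path.trans (loopMap k hk (f.1 x)) (loopMap k hk (g.1 x))) s
  simp only [Path.trans_apply]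
  split_ifs <;> rfl

end PairClass

/-! ### Generalized cohomology -/

/-- An `Ω`-spectrum: pointed spaces `F n`, `n ∈ ℤ`, with pointed homotopy equivalences
`F n ≃ Ω F (n + 1)`. -/
structure OmegaSpectrum where
  space : ℤ → Type v
  [top : ∀ n, TopologicalSpace (space n)]
  pt : ∀ n, space n
  toLoop : ∀ n, C(space n, Path (pt (n + 1)) (pt (n + 1)))
  ofLoop : ∀ n, C(Path (pt (n + 1)) (pt (n + 1)), space n)
  toLoop_pt : ∀ n, toLoop n (pt n) = Path.refl (pt (n + 1))
  ofLoop_pt : ∀ n, ofLoop n (Path.refl (pt (n + 1))) = pt n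
  ofLoop_toLoop : ∀ n,
    ((ofLoop n).comp (toLoop n)).HomotopicRel (ContinuousMap.id _) {pt n}
  toLoop_ofLoop : ∀ n,
    ((toLoop n).comp (ofLoop n)).HomotopicRel (ContinuousMap.id _) {Path.refl (pt (n + 1))}

attribute [instance] OmegaSpectrum.top

/-- The generalized cohomology `h^n(X, Y) = [(X, Y), (F n, *)]` of a pair. -/
def Cohomology (F : OmegaSpectrum.{v}) (n : ℤ) (X : Type*) [TopologicalSpace X] (Y : Set X) :=
  PairClass X Y (F.space n) (F.pt n)

namespace Cohomology

variable (F : OmegaSpectrum.{v}) (n : ℤ) (X : Type*) [TopologicalSpace X] (Y : Set X)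

/-- The identification of `h^n(X, Y)` with classes of maps into `Ω F (n + 1)`. -/
def loopEquiv : Cohomology F n X Y ≃
    PairClass X Y (Path (F.pt (n + 1)) (F.pt (n + 1))) (Path.refl (F.pt (n + 1))) :=
  PairClass.pushEquiv X Y (F.toLoop n) (F.ofLoop n) (F.toLoop_pt n) (F.ofLoop_pt n)
    (F.ofLoop_toLoop n) (F.toLoop_ofLoop n)

theorem loop_concat_comm
    (a b : PairClass X Y (Path (F.pt (n + 1)) (F.pt (n + 1))) (Path.refl (F.pt (n + 1)))) :
    PairClass.concat a b = PairClass.concat b a := by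
  have hinj := Function.LeftInverse.injective (PairClass.push_comp_eq (X := X) (Y := Y)
    (PairClass.loopMap_refl _ (F.toLoop_pt (n + 1)))
    (PairClass.loopMap_refl _ (F.ofLoop_pt (n + 1)))
    (PairClass.loopMap_comp_homotopicRel (F.toLoop_pt (n + 1)) (F.ofLoop_pt (n + 1))
      (F.ofLoop_toLoop (n + 1))))
  apply hinj
  rw [PairClass.push_loopMap_concat, PairClass.push_loopMap_concat, PairClass.concat_comm]

/-- The abelian group structure of `h^n(X, Y)`: concatenation of loops, through
`F n ≃ Ω F (n + 1)`. -/
instance addCommGroup : AddCommGroup (Cohomology F n X Y) :=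
  letI : CommGroup
      (PairClass X Y (Path (F.pt (n + 1)) (F.pt (n + 1))) (Path.refl (F.pt (n + 1)))) :=
    { PairClass.loopGroup X Y (F.pt (n + 1)) with mul_comm := loop_concat_comm F n X Y }
  ((loopEquiv F n X Y).trans Additive.ofMul).addCommGroup

/-- Addition in `h^n(X, Y)` is characterized by concatenation of loops. -/
theorem loopEquiv_add (a b : Cohomology F n X Y) :
    loopEquiv F n X Y (a + b) =
      PairClass.concat (loopEquiv F n X Y a) (loopEquiv F n X Y b) :=
  (loopEquiv F n X Y).apply_symm_apply _

variable {X Y} in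
/-- The map `h^n(X', Y') → h^n(X, Y)` induced by a map of pairs `(X, Y) → (X', Y')`. -/
def pull {X' : Type*} [TopologicalSpace X'] {Y' : Set X'} (k : C(X, X'))
    (hk : ∀ y ∈ Y, k y ∈ Y') : Cohomology F n X' Y' → Cohomology F n X Y :=
  PairClass.pull (F.space n) (F.pt n) k hk

end Cohomology

/-! ### Universal free `G`-spaces and Borel equivariant cohomology -/

/-- The orbit space `X / G`, with the quotient topology. -/
abbrev OrbitSpace (G : Type*) [Group G] (X : Type*) [MulAction G X] :=
  Quotient (MulAction.orbitRel G X)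

/-- `E` is a model of `EG` for the discrete group `G`: it is contractible, `G` acts by
homeomorphisms, and `E → E / G` is a (numerable) principal `G`-bundle, that is, there is a
partition of unity on `E / G` such that over each open set where a member of it is nonzero the
bundle is trivial (there is a locally constant equivariant map to `G`). -/
structure IsUniversalSpace (G : Type*) [Group G] (E : Type*) [TopologicalSpace E]
    [MulAction G E] : Prop where
  contractible : ContractibleSpace E
  continuous_smul : ContinuousConstSMul G E
  numerable : ∃ ρ : PartitionOfUnity ℕ (OrbitSpace G E), ∀ i, ∃ γ : E → G,
    (∀ g e, ρ i (Quotient.mk _ e) ≠ 0 → γ (g • e) = g * γ e) ∧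
    IsLocallyConstant fun e : {e : E // ρ i (Quotient.mk _ e) ≠ 0} => γ e

/-- The Borel construction `E ×_G X = (E × X) / G`. -/
abbrev BorelConstruction (G : Type*) [Group G] (E X : Type*) [MulAction G E] [MulAction G X] :=
  OrbitSpace G (E × X)

/-- The subspace `E ×_G Y` of `E ×_G X`, for an invariant subset `Y` of `X`. -/
def borelSet (G : Type*) [Group G] (E : Type*) {X : Type*} [MulAction G E] [MulAction G X]
    (Y : Set X) : Set (BorelConstruction G E X) :=
  Quotient.mk _ '' {q : E × X | q.2 ∈ Y}

/-- The Borel equivariant cohomology `h^n_G(X, Y) = h^n(EG ×_G X, EG ×_G Y)`, where `E` is the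
model of `EG` used. -/
abbrev EquivariantCohomology (F : OmegaSpectrum.{v}) (G : Type*) [Group G] (n : ℤ)
    (E X : Type*) [TopologicalSpace E] [MulAction G E] [TopologicalSpace X] [MulAction G X]
    (Y : Set X) :=
  Cohomology F n (BorelConstruction G E X) (borelSet G E Y)

/-- The interval `[0, 1]` with the `G`-action `g • x = 1/2 + φ(g) (x - 1/2)`. -/
def TwistedInterval {G : Type*} [Group G] (_φ : G →* ℤˣ) := unitInterval

namespace TwistedInterval

variable {G : Type*} [Group G] (φ : G →* ℤˣ)

instance : TopologicalSpace (TwistedInterval φ) := inferInstanceAs (TopologicalSpace unitInterval)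

instance : MulAction G (TwistedInterval φ) where
  smul g x := ⟨1 / 2 + ((φ g : ℤ) : ℝ) * ((x : unitInterval) - 1 / 2 : ℝ), by
    have h : (0 : ℝ) ≤ (x : unitInterval).1 ∧ (x : unitInterval).1 ≤ 1 :=
      ⟨unitInterval.nonneg (x : unitInterval), unitInterval.le_one (x : unitInterval)⟩
    rcases Int.units_eq_one_or (φ g) with hg | hg <;> rw [hg] <;> push_cast <;>
      constructor <;> linarith⟩
  one_smul x := Subtype.ext (by
    change 1 / 2 + ((φ 1 : ℤ) : ℝ) * ((x : unitInterval) - 1 / 2 : ℝ) = (x : unitInterval)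
    rw [map_one]
    push_cast
    ring)
  mul_smul g k x := Subtype.ext (by
    change 1 / 2 + ((φ (g * k) : ℤ) : ℝ) * ((x : unitInterval) - 1 / 2 : ℝ) =
      1 / 2 + ((φ g : ℤ) : ℝ) *
        ((1 / 2 + ((φ k : ℤ) : ℝ) * ((x : unitInterval) - 1 / 2 : ℝ)) - 1 / 2)
    rw [map_mul]
    push_cast
    ring)

theorem smul_coe (g : G) (x : TwistedInterval φ) :
    ((g • x : TwistedInterval φ) : unitInterval).1 =
      1 / 2 + ((φ g : ℤ) : ℝ) * ((x : unitInterval).1 - 1 / 2) := rfl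

/-- The endpoints `∂I = {0, 1}`. -/
def boundary : Set (TwistedInterval φ) := ({0, 1} : Set unitInterval)

end TwistedInterval

/-- The twisted equivariant cohomology
`h^{φ + n}_G(X, Y) = h^{n + 1}_G(X × I, Y × I ∪ X × ∂I)`, where `G` acts on `I` through `φ`. -/
abbrev TwistedCohomology (F : OmegaSpectrum.{v}) {G : Type*} [Group G] (φ : G →* ℤˣ) (n : ℤ)
    (E X : Type*) [TopologicalSpace E] [MulAction G E] [TopologicalSpace X] [MulAction G X]
    (Y : Set X) :=
  EquivariantCohomology F G (n + 1) E (X × TwistedInterval φ)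
    {q | q.1 ∈ Y ∨ q.2 ∈ TwistedInterval.boundary φ}

/-- The map `h^{φ₂ + n}_{G₂}(pt) → h^{φ₁ + n}_{G₁}(pt)` induced by a homomorphism
`f : G₁ → G₂` with `φ₂ ∘ f = φ₁`, computed from an `f`-equivariant map `k : EG₁ → EG₂`. -/
def TwistedCohomology.pullPt (F : OmegaSpectrum.{v}) (n : ℤ)
    {G₁ G₂ : Type*} [Group G₁] [Group G₂] {φ₁ : G₁ →* ℤˣ} {φ₂ : G₂ →* ℤˣ} (f : G₁ →* G₂)
    (hf : ∀ g, φ₂ (f g) = φ₁ g) {E₁ E₂ : Type*} [TopologicalSpace E₁] [MulAction G₁ E₁]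
    [TopologicalSpace E₂] [MulAction G₂ E₂] (k : C(E₁, E₂)) (hk : ∀ g e, k (g • e) = f g • k e) :
    TwistedCohomology F φ₂ n E₂ PUnit.{1} ∅ → TwistedCohomology F φ₁ n E₁ PUnit.{1} ∅ :=
  Cohomology.pull F (n + 1)
    { toFun := Quotient.map
        (fun q => (k q.1, (q.2.1, (q.2.2 : unitInterval))) :
          E₁ × PUnit.{1} × TwistedInterval φ₁ → E₂ × PUnit.{1} × TwistedInterval φ₂)
        (by
          rintro _ q ⟨g, rfl⟩
          refine ⟨f g, Prod.ext (hk g q.1).symm (Prod.ext rfl (Subtype.ext ?_))⟩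
          change _ = ((g • q.2.2 : TwistedInterval φ₁) : unitInterval).1
          rw [TwistedInterval.smul_coe, ← hf]
          rfl)
      continuous_toFun := Continuous.quotient_map' (by
        refine Continuous.prodMk (by fun_prop) (Continuous.prodMk (by fun_prop) ?_)
        exact continuous_snd.comp continuous_snd) _ }
    (by
      rintro _ ⟨q, hq, rfl⟩
      rcases hq with hq | hq
      · exact hq.elim
      · exact ⟨(k q.1, (q.2.1, (q.2.2 : unitInterval))), Or.inr hq, rfl⟩)

/-! ### The generalized cohomology hypothesis -/

/-- The category of pairs `(G, φ)` of a (discrete) group with a homomorphism `φ : G → {±1}`; a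
morphism `(G₁, φ₁) → (G₂, φ₂)` is a homomorphism `f : G₁ → G₂` with `φ₂ ∘ f = φ₁`. -/
abbrev SymmetryPair := CategoryTheory.Over (GrpCat.of.{0} ℤˣ)

/-- The pair `(G, φ)`. -/
abbrev SymmetryPair.of (G : Type) [Group G] (φ : G →* ℤˣ) : SymmetryPair :=
  CategoryTheory.Over.mk (GrpCat.ofHom φ)

/-- The homomorphism `φ` of a pair `(G, φ)`. -/
abbrev SymmetryPair.sign (A : SymmetryPair) : A.left →* ℤˣ := A.hom.hom

theorem SymmetryPair.sign_comp {A B : SymmetryPair} (f : A ⟶ B) (g : A.left) :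
    B.sign (f.left.hom g) = A.sign g :=
  congrArg (fun q : A.left ⟶ GrpCat.of.{0} ℤˣ => q.hom g) (CategoryTheory.Over.w f)

/-- The generalized cohomology hypothesis for a classification of SPT phases and an
`Ω`-spectrum `F`. The classification assigns to every dimension `d` an abelian group
`SPT^d(G, φ)`, contravariant in `(G, φ)`. The hypothesis says that there are isomorphisms of
abelian groups `SPT^d(G, φ) ≅ h^{φ + d}_G(pt)`, natural in `(G, φ)`; the right-hand side may be
computed from any model of `EG`. -/
def GeneralizedCohomologyHypothesis
    (SPT : ℕ → CategoryTheory.Functor SymmetryPairᵒᵖ AddCommGrpCat.{w}) (F : OmegaSpectrum.{v}) :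
    Prop :=
  ∀ d : ℕ, ∃ Θ : ∀ (A : SymmetryPair) (E : Type u) [TopologicalSpace E] [MulAction A.left E],
      IsUniversalSpace A.left E →
        ((SPT d).obj (.op A) ≃+ TwistedCohomology F A.sign d E PUnit.{1} ∅),
    ∀ (A B : SymmetryPair) (f : A ⟶ B) (E₁ E₂ : Type u)
      [TopologicalSpace E₁] [MulAction A.left E₁] [TopologicalSpace E₂] [MulAction B.left E₂]
      (h₁ : IsUniversalSpace A.left E₁) (h₂ : IsUniversalSpace B.left E₂)
      (k : C(E₁, E₂)) (hk : ∀ g e, k (g • e) = f.left.hom g • k e) (s : (SPT d).obj (.op B)),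
      Θ A E₁ h₁ ((SPT d).map f.op s) =
        TwistedCohomology.pullPt F d f.left.hom (SymmetryPair.sign_comp f) k hk (Θ B E₂ h₂ s)

/-! ### Space groups -/

/-- Euclidean space `ℝ^d`. -/
abbrev Euc (d : ℕ) := EuclideanSpace ℝ (Fin d)

/-- The group `ℝ^d ⋊ O(d)` of isometries of `ℝ^d`. -/
abbrev EucGroup (d : ℕ) := Euc d ≃ᵃⁱ[ℝ] Euc d

/-- The isometry `(v, p) : x ↦ v + p x`. -/
def EucGroup.mk {d : ℕ} (v : Euc d) (p : Euc d ≃ₗᵢ[ℝ] Euc d) : EucGroup d :=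
  AffineIsometryEquiv.constVAdd ℝ (Euc d) v * p.toAffineIsometryEquiv

theorem EucGroup.mk_apply {d : ℕ} (v : Euc d) (p : Euc d ≃ₗᵢ[ℝ] Euc d) (x : Euc d) :
    EucGroup.mk v p x = v + p x := rfl

/-- The projection `ℝ^d ⋊ O(d) → O(d)`. -/
def EucGroup.linear (d : ℕ) : EucGroup d →* (Euc d ≃ₗᵢ[ℝ] Euc d) where
  toFun g := g.linearIsometryEquiv
  map_one' := rfl
  map_mul' _ _ := rfl

theorem EucGroup.linear_mk {d : ℕ} (v : Euc d) (p : Euc d ≃ₗᵢ[ℝ] Euc d) :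
    EucGroup.linear d (EucGroup.mk v p) = p := by
  ext x
  rfl

instance EucGroup.mulAction (d : ℕ) : MulAction (EucGroup d) (Euc d) where
  smul g x := g x
  one_smul _ := rfl
  mul_smul _ _ _ := rfl

theorem EucGroup.smul_def {d : ℕ} (g : EucGroup d) (x : Euc d) : g • x = g x := rfl

/-- The homomorphism `O(d) → {±1}`, equal to `-1` on orientation-reversing maps. -/
def orientationSign (d : ℕ) : (Euc d ≃ₗᵢ[ℝ] Euc d) →* ℤˣ where
  toFun p := if 0 < LinearMap.det (p.toLinearEquiv : Euc d →ₗ[ℝ] Euc d) then 1 else -1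
  map_one' := by
    have : ((1 : Euc d ≃ₗᵢ[ℝ] Euc d).toLinearEquiv : Euc d →ₗ[ℝ] Euc d) = LinearMap.id := rfl
    simp [this]
  map_mul' p q := by
    have h : ((p * q).toLinearEquiv : Euc d →ₗ[ℝ] Euc d) =
      (p.toLinearEquiv : Euc d →ₗ[ℝ] Euc d) ∘ₗ (q.toLinearEquiv : Euc d →ₗ[ℝ] Euc d) := rfl
    have hp : LinearMap.det (p.toLinearEquiv : Euc d →ₗ[ℝ] Euc d) ≠ 0 :=
      p.toLinearEquiv.isUnit_det'.ne_zero
    have hq : LinearMap.det (q.toLinearEquiv : Euc d →ₗ[ℝ] Euc d) ≠ 0 :=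
      q.toLinearEquiv.isUnit_det'.ne_zero
    rw [h, LinearMap.det_comp]
    rcases lt_or_gt_of_ne hp with hp | hp <;> rcases lt_or_gt_of_ne hq with hq | hq
    · simp [hp.not_gt, hq.not_gt, mul_pos_of_neg_of_neg hp hq]
    · simp [hp.not_gt, hq, (mul_neg_of_neg_of_pos hp hq).not_gt]
    · simp [hp, hq.not_gt, (mul_neg_of_pos_of_neg hp hq).not_gt]
    · simp [hp, hq]

/-- A `d`-dimensional space group: a discrete group of isometries of `ℝ^d` with compact
fundamental domain. -/
structure IsSpaceGroup {d : ℕ} (G : Subgroup (EucGroup d)) : Prop where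
  properlyDiscontinuous : ProperlyDiscontinuousSMul G (Euc d)
  compact : CompactSpace (OrbitSpace G (Euc d))

section SpaceGroup

variable {d : ℕ} (G : Subgroup (EucGroup d))

/-- The point group `P`: the image of `G` in `O(d)`. -/
abbrev pointGroup : Subgroup (Euc d ≃ₗᵢ[ℝ] Euc d) := G.map (EucGroup.linear d)

/-- The projection `π : G → P`. -/
def pointProj : G →* pointGroup G := (EucGroup.linear d).subgroupMap G

theorem pointProj_surjective : Function.Surjective (pointProj G) :=
  (EucGroup.linear d).subgroupMap_surjective G

/-- The translation group `Π`: the elements of `G` with trivial linear part. -/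
abbrev translationGroup : Subgroup G := (pointProj G).ker

/-- `BΠ = ℝ^d / Π`. -/
abbrev BTrans := OrbitSpace (translationGroup G) (Euc d)

/-- The map of `BΠ` induced by an element of `G`. -/
def BTrans.map (g : G) : BTrans G → BTrans G :=
  Quotient.map (fun x => g • x) (by
    rintro _ y ⟨n, rfl⟩
    refine ⟨⟨g * n * g⁻¹, (MonoidHom.normal_ker (pointProj G)).conj_mem n n.2 g⟩, ?_⟩
    change (g * n * g⁻¹) • g • y = g • (n : G) • y
    simp [mul_smul])

theorem BTrans.map_eq {g k : G} (h : pointProj G g = pointProj G k) :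
    BTrans.map G g = BTrans.map G k := by
  funext x
  induction x using Quotient.inductionOn with
  | h x =>
  refine Quotient.sound ⟨⟨g * k⁻¹, ?_⟩, ?_⟩
  · simp [MonoidHom.mem_ker, h]
  · change (g * k⁻¹) • k • x = g • x
    simp [mul_smul]

/-- The action of `P` on `BΠ`: `p • [v] = [a(p) + p v]` for any lift `(a(p), p) ∈ G` of `p`. -/
instance BTrans.mulAction : MulAction (pointGroup G) (BTrans G) where
  smul p x := BTrans.map G (Function.surjInv (pointProj_surjective G) p) x
  one_smul x := by
    change BTrans.map G _ x = x
    rw [BTrans.map_eq G (k := 1)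
      ((Function.surjInv_eq (pointProj_surjective G) 1).trans (map_one _).symm)]
    induction x using Quotient.inductionOn with
    | h x => exact congrArg (Quotient.mk _) (one_smul G x)
  mul_smul p q x := by
    change BTrans.map G _ x = BTrans.map G _ (BTrans.map G _ x)
    rw [BTrans.map_eq G (k := Function.surjInv (pointProj_surjective G) p *
      Function.surjInv (pointProj_surjective G) q) (by simp only [Function.surjInv_eq, map_mul])]
    induction x using Quotient.inductionOn with
    | h x => exact congrArg (Quotient.mk _) (mul_smul _ _ x)

theorem BTrans.smul_mk (g : G) (v : Euc d) :
    pointProj G g • (Quotient.mk _ v : BTrans G) = Quotient.mk _ (g • v) :=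
  congrFun (BTrans.map_eq G (Function.surjInv_eq (pointProj_surjective G) (pointProj G g)))
    (Quotient.mk _ v)

theorem BTrans.smul_lift (p : pointGroup G) (a : Euc d) (ha : EucGroup.mk a p ∈ G) (v : Euc d) :
    p • (Quotient.mk _ v : BTrans G) = Quotient.mk _ (a + (p : Euc d ≃ₗᵢ[ℝ] Euc d) v) := by
  have h : pointProj G ⟨EucGroup.mk a p, ha⟩ = p := Subtype.ext (EucGroup.linear_mk a p)
  have := BTrans.smul_mk G ⟨EucGroup.mk a p, ha⟩ v
  rw [h] at this
  exact this

variable {G}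

/-- The homomorphism `φ = φ_int φ_spa`, where `φ_int(g) = -1` if `g` acts antiunitarily and
`φ_spa(g) = -1` if `g` reverses orientation. -/
def symmetrySign (φint : G →* ℤˣ) : G →* ℤˣ :=
  φint * ((orientationSign d).comp ((EucGroup.linear d).comp G.subtype))

theorem symmetrySign_translation (φint : G →* ℤˣ) (h : ∀ t ∈ translationGroup G, φint t = 1) :
    (pointProj G).ker ≤ (symmetrySign φint).ker := by
  intro t ht
  have h1 : EucGroup.linear d (t : EucGroup d) = 1 := congrArg Subtype.val ht
  change φint t * orientationSign d (EucGroup.linear d (t : EucGroup d)) = 1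
  rw [h t ht, h1, map_one, one_mul]

/-- When translations act unitarily, `φ` factors through a homomorphism `P → {±1}`. -/
def pointSign (φint : G →* ℤˣ) (h : ∀ t ∈ translationGroup G, φint t = 1) :
    pointGroup G →* ℤˣ :=
  (pointProj G).liftOfSurjective (pointProj_surjective G)
    ⟨symmetrySign φint, symmetrySign_translation φint h⟩

theorem pointSign_pointProj (φint : G →* ℤˣ) (h : ∀ t ∈ translationGroup G, φint t = 1) (g : G) :
    pointSign φint h (pointProj G g) = symmetrySign φint g :=
  MonoidHom.liftOfRightInverse_comp_apply _ _ _ _ g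

end SpaceGroup

/-- An `H`-space `E`, viewed as a `G`-space through a homomorphism `f : G → H`. -/
def RestrictAlong {G H : Type*} [Group G] [Group H] (_f : G →* H) (E : Type*) := E

instance {G H : Type*} [Group G] [Group H] (f : G →* H) (E : Type*) [TopologicalSpace E] :
    TopologicalSpace (RestrictAlong f E) := inferInstanceAs (TopologicalSpace E)

instance {G H : Type*} [Group G] [Group H] (f : G →* H) (E : Type*) [MulAction H E] :
    MulAction G (RestrictAlong f E) := MulAction.compHom E f

end

/-! A numerable free `G`-space maps equivariantly to every contractible `G`-space, uniquely up to
equivariant homotopy. Both facts are instances of `exists_equivariant_extension`: where a local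
equivariant map to `G` trivializes the action, a partially defined equivariant map is extended by
contracting the target, and a locally finite sequence of such extensions stabilizes near each point.
Hence two models of `EG` are equivariantly homotopy equivalent, so neither the homotopy type of `EG
/ G` nor Borel cohomology depends on the model.

It remains to choose good models. On `ℝ^d × EP` the action of `G` is trivialized in two stages, `P`
by means of `EP` and `Π` by means of an explicit `sin²`, `cos²` partition of unity on `ℝ^d`
(`isNumerableSpace_prod`). Dividing by `Π` first leaves `P` acting on `BΠ × EP`. More generally, the
`G`-orbits on `ℝ^d × W` match the `P`-orbits on `BΠ × W` when `G` acts on `W` through `P`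
(`BTrans.exists_smul_mk_eq_iff`). The case `W = EP` gives the homeomorphism of Borel constructions.
The case of `EP` times the twisted interval, on which `Π` acts trivially because `φ` does, gives
`h_G(pt) ≅ h_P(BΠ)`.

The product `EG × ℝ^d` is a model of `EG` as well. The cohomology of a point computed from it is
that of `ℝ^d` computed from `EG`, whence the second isomorphism. The statement on SPT phases follows
by composition with the isomorphism of the hypothesis. -/

noncomputable section

open Filter Topology Function

/-! ### Extension of equivariant maps into a contractible space -/

section EquivariantExtension

variable {G Y X : Type*} [Group G] [TopologicalSpace X] [MulAction G X]

/-- The interpolation parameter, equal to `0` where `2 r ≤ s` and to `1` where `2 s ≤ r`. -/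
def blendParam (s r : ℝ) : I := Set.projIcc 0 1 zero_le_one ((2 * r - s) / (s + r))

theorem blendParam_eq_zero {s r : ℝ} (h : 2 * r ≤ s) (hr : 0 ≤ s + r) : blendParam s r = 0 :=
  Set.projIcc_of_le_left _ (div_nonpos_of_nonpos_of_nonneg (by linarith) hr)

theorem blendParam_eq_one {s r : ℝ} (h : 2 * s ≤ r) (hr : 0 < s + r) : blendParam s r = 1 :=
  Set.projIcc_of_right_le _ ((one_le_div hr).2 (by linarith))

theorem ContinuousAt.blendParam [TopologicalSpace Y] {s r : Y → ℝ} {y : Y} (hs : ContinuousAt s y)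
    (hr : ContinuousAt r y) (h : 0 < s y + r y) :
    ContinuousAt (fun z => blendParam (s z) (r z)) y :=
  continuous_projIcc.continuousAt.comp (by fun_prop (disch := exact h.ne'))

open Classical in
/-- Extend an equivariant map `f`, given where `s > 0`, over the open set `r > 0`, on which a local
equivariant map `γ` to `G` trivializes the action: contract along `h` in the coordinates
given by `γ`. -/
def blend (x₀ : X) (h : (ContinuousMap.id X).Homotopy (ContinuousMap.const X x₀))
    (s r : Y → ℝ) (γ : Y → G) (f : Y → X) (y : Y) : X :=
  if r y = 0 then f y
  else if s y = 0 then γ y • x₀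
  else γ y • h (blendParam (s y) (r y), (γ y)⁻¹ • f y)

variable {x₀ : X} {h : (ContinuousMap.id X).Homotopy (ContinuousMap.const X x₀)}
  {s r : Y → ℝ} {γ : Y → G} {f : Y → X}

theorem blend_of_eq_zero {y : Y} (hy : r y = 0) : blend x₀ h s r γ f y = f y := if_pos hy

/-- In the coordinates given by `γ` the vector `(γ y)⁻¹ • f y` is invariant, so the contraction `h`,
which is not equivariant, may be applied to it. -/
theorem blend_smul [MulAction G Y] (hsG : ∀ (g : G) y, s (g • y) = s y)
    (hs : ∀ y, 0 ≤ s y)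
    (hrG : ∀ (g : G) y, r (g • y) = r y) (hγ : ∀ g y, r y ≠ 0 → γ (g • y) = g * γ y)
    (hf : ∀ (g : G) y, 0 < s y → f (g • y) = g • f y) (g : G) (y : Y) (hy : 0 < s y + r y) :
    blend x₀ h s r γ f (g • y) = g • blend x₀ h s r γ f y := by
  unfold blend
  rw [hsG, hrG]
  split_ifs with h1 h2
  · exact hf g y (by linarith)
  · rw [hγ g y h1, mul_smul]
  · rw [hγ g y h1, hf g y ((hs y).lt_of_ne' h2), mul_smul, mul_inv_rev, mul_smul, inv_smul_smul]

/-- Nothing is known of `f` where `s = 0`, nor of `γ` where `r = 0`. The buffer zones of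
`blendParam` deal with this: for `2 r < s` the result is `f` itself, for `2 s < r` it is `γ • x₀`,
and elsewhere both `s` and `r` are positive and the formula is continuous. -/
theorem continuousAt_blend [TopologicalSpace Y] [ContinuousConstSMul G X] (hsc : Continuous s) (hrc : Continuous r)
    (hs : ∀ y, 0 ≤ s y) (hr : ∀ y, 0 ≤ r y)
    (hγ : ∀ y, r y ≠ 0 → ∀ᶠ z in 𝓝 y, γ z = γ y)
    (hf : ∀ y, 0 < s y → ContinuousAt f y) (y : Y) (hy : 0 < s y + r y) :
    ContinuousAt (blend x₀ h s r γ f) y := by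
  by_cases h1 : 2 * r y < s y
  · refine (hf y (by linarith [hr y])).congr ?_
    filter_upwards [(hrc.const_mul 2).continuousAt.eventually_lt hsc.continuousAt h1] with z (hz : 2 * r z < s z)
    unfold blend
    split_ifs with h2 h3
    · rfl
    · linarith [hr z]
    · rw [blendParam_eq_zero hz.le (by linarith [hr z, hs z])]
      simp
  have hry : 0 < r y := by linarith [hs y]
  have hγy := hγ y hry.ne'
  by_cases h2 : 2 * s y < r y
  · refine (continuousAt_const (y := γ y • x₀)).congr ?_
    filter_upwards [(hsc.const_mul 2).continuousAt.eventually_lt hrc.continuousAt h2, hγy] with z (hz : 2 * s z < r z) hz'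
    unfold blend
    split_ifs with h3 h4
    · linarith [hs z]
    · rw [hz']
    · rw [blendParam_eq_one hz.le (by linarith [hr z, hs z]), hz']
      simp
  have hsy : 0 < s y := by linarith
  have key : ContinuousAt
      (fun z => γ y • h (blendParam (s z) (r z), (γ y)⁻¹ • f z)) y := by
    have h3 : ContinuousAt (fun z => (blendParam (s z) (r z), (γ y)⁻¹ • f z)) y :=
      (ContinuousAt.blendParam hsc.continuousAt hrc.continuousAt hy).prodMk
        ((hf y hsy).const_smul _)
    exact ((map_continuous h).continuousAt.comp h3).const_smul (γ y)
  refine key.congr ?_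
  filter_upwards [hγy, hsc.continuousAt.eventually_ne hsy.ne',
    hrc.continuousAt.eventually_ne hry.ne'] with z h3 h4 h5
  simp [blend, h3, h4, h5]

/-- The maps obtained from `f` by successively extending over the sets `ρ 0 > 0`, `ρ 1 > 0`, … -/
def blendSeq (x₀ : X) (h : (ContinuousMap.id X).Homotopy (ContinuousMap.const X x₀))
    (s : Y → ℝ) (ρ : ℕ → Y → ℝ) (γ : ℕ → Y → G) (f : Y → X) : ℕ → Y → X
  | 0 => f
  | n + 1 => blend x₀ h (fun y => s y + ∑ i ∈ Finset.range n, ρ i y) (ρ n) (γ n)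
      (blendSeq x₀ h s ρ γ f n)

theorem blendSeq_eq_of_le {ρ : ℕ → Y → ℝ} {γ : ℕ → Y → G} {y : Y} {N n : ℕ}
    (hN : ∀ n, N ≤ n → ρ n y = 0) (hn : N ≤ n) :
    blendSeq x₀ h s ρ γ f n y = blendSeq x₀ h s ρ γ f N y := by
  induction n, hn using Nat.le_induction with
  | base => rfl
  | succ n hn ih => exact (blend_of_eq_zero (hN n hn)).trans ih

/-- Induction on the stage: each blend adds `ρ n` to the function whose positivity set is the good
domain. -/
theorem blendSeq_properties [TopologicalSpace Y] [MulAction G Y] [ContinuousConstSMul G X]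
    {ρ : ℕ → Y → ℝ} {γ : ℕ → Y → G}
    (hsc : Continuous s) (hs : ∀ y, 0 ≤ s y) (hsG : ∀ (g : G) y, s (g • y) = s y)
    (hfc : ∀ y, 0 < s y → ContinuousAt f y) (hfG : ∀ (g : G) y, 0 < s y → f (g • y) = g • f y)
    (hρc : ∀ n, Continuous (ρ n)) (hρ : ∀ n y, 0 ≤ ρ n y)
    (hρG : ∀ n (g : G) y, ρ n (g • y) = ρ n y)
    (hγ : ∀ n g y, ρ n y ≠ 0 → γ n (g • y) = g * γ n y)
    (hγc : ∀ n y, ρ n y ≠ 0 → ∀ᶠ z in 𝓝 y, γ n z = γ n y) (n : ℕ) :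
    (∀ y, 0 < s y + ∑ i ∈ Finset.range n, ρ i y →
      ContinuousAt (blendSeq x₀ h s ρ γ f n) y) ∧
    ∀ (g : G) y, 0 < s y + ∑ i ∈ Finset.range n, ρ i y →
      blendSeq x₀ h s ρ γ f n (g • y) = g • blendSeq x₀ h s ρ γ f n y := by
  induction n with
  | zero => exact ⟨by simpa [blendSeq] using hfc, by simpa [blendSeq] using hfG⟩
  | succ n ih =>
    have hnn : ∀ y, 0 ≤ s y + ∑ i ∈ Finset.range n, ρ i y := fun y =>
      add_nonneg (hs y) (Finset.sum_nonneg fun i _ => hρ i y)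
    simp only [Finset.sum_range_succ, ← add_assoc]
    constructor
    · intro y hy
      exact continuousAt_blend (by fun_prop) (hρc n) hnn (hρ n) (hγc n) ih.1 y hy
    · intro g y hy
      refine blend_smul ?_ hnn (hρG n) (hγ n) ih.2 g y hy
      intro g y
      simp only [hsG, hρG]

/-- Extension of equivariant maps to a contractible `G`-space over numerable free `G`-spaces. -/
theorem exists_equivariant_extension [TopologicalSpace Y] [MulAction G Y]
    [ContinuousConstSMul G X] [ContractibleSpace X]
    {ρ : ℕ → Y → ℝ} {γ : ℕ → Y → G}
    (hsc : Continuous s) (hs : ∀ y, 0 ≤ s y) (hsG : ∀ (g : G) y, s (g • y) = s y)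
    (hfc : ∀ y, 0 < s y → ContinuousAt f y) (hfG : ∀ (g : G) y, 0 < s y → f (g • y) = g • f y)
    (hρc : ∀ n, Continuous (ρ n)) (hρ : ∀ n y, 0 ≤ ρ n y)
    (hρG : ∀ n (g : G) y, ρ n (g • y) = ρ n y) (hfin : LocallyFinite fun n => support (ρ n))
    (hγ : ∀ n g y, ρ n y ≠ 0 → γ n (g • y) = g * γ n y)
    (hγc : ∀ n y, ρ n y ≠ 0 → ∀ᶠ z in 𝓝 y, γ n z = γ n y)
    (hpos : ∀ y, s y = 0 → ∃ n, ρ n y ≠ 0) :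
    ∃ k : C(Y, X), (∀ (g : G) y, k (g • y) = g • k y) ∧
      ∀ y, (∀ n, ρ n y = 0) → k y = f y := by
  obtain ⟨x₀, ⟨h⟩⟩ := id_nullhomotopic X
  -- Local finiteness: from stage `N y` on, no blend changes anything near `y`. The extension is `y
  -- ↦ F (N y) y`.
  have hN : ∀ y, ∃ N, ∀ᶠ z in 𝓝 y, ∀ n, N ≤ n → ρ n z = 0 := by
    intro y
    obtain ⟨t, ht, hft⟩ := hfin y
    obtain ⟨N, hN⟩ := hft.bddAbove
    refine ⟨N + 1, ?_⟩
    filter_upwards [ht] with z hz n hn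
    by_contra hne
    have : n ≤ N := hN ⟨z, hne, hz⟩
    omega
  choose N hN using hN
  set F := blendSeq x₀ h s ρ γ f
  -- `N` itself may jump, but the stage can be frozen near `y`, which reduces continuity to that of
  -- a single stage.
  have hF : ∀ y, ∀ᶠ z in 𝓝 y, F (N z) z = F (N y) z := by
    intro y
    filter_upwards [hN y] with z hz
    rcases le_total (N z) (N y) with hle | hle
    · exact (blendSeq_eq_of_le (hN z).self_of_nhds hle).symm
    · exact blendSeq_eq_of_le hz hle
  have hsum : ∀ y n, N y ≤ n → 0 < s y + ∑ i ∈ Finset.range n, ρ i y := by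
    intro y n hn
    rcases (hs y).eq_or_lt' with h0 | h0
    · obtain ⟨m, hm⟩ := hpos y h0
      have hlt : m < n := lt_of_not_ge fun hle => hm ((hN y).self_of_nhds m (hn.trans hle))
      have := Finset.single_le_sum (f := fun i => ρ i y) (fun i _ => hρ i y)
        (Finset.mem_range.2 hlt)
      have := (hρ m y).lt_of_ne' hm
      linarith
    · exact add_pos_of_pos_of_nonneg h0 (Finset.sum_nonneg fun i _ => hρ i y)
  have hprop := blendSeq_properties (x₀ := x₀) (h := h) hsc hs hsG hfc hfG hρc hρ hρG hγ hγc
  refine ⟨⟨fun y => F (N y) y, continuous_iff_continuousAt.2 fun y => ?_⟩, fun g y => ?_,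
    fun y hy => ?_⟩
  · exact ((hprop (N y)).1 y (hsum y _ le_rfl)).congr
      ((hF y).mono fun z hz => hz.symm)
  · change F (N (g • y)) (g • y) = g • F (N y) y
    -- The points `y` and `g • y` are compared at a stage where both have stabilized.
    have e₁ : F (max (N y) (N (g • y))) (g • y) = F (N (g • y)) (g • y) :=
      blendSeq_eq_of_le (hN (g • y)).self_of_nhds (le_max_right _ _)
    have e₂ : F (max (N y) (N (g • y))) y = F (N y) y :=
      blendSeq_eq_of_le (hN y).self_of_nhds (le_max_left _ _)
    rw [← e₁, ← e₂]
    exact (hprop _).2 g y (hsum y _ (le_max_left _ _))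
  · exact blendSeq_eq_of_le (N := 0) (fun n _ => hy n) (Nat.zero_le _)

end EquivariantExtension

/-! ### Maps between universal spaces -/

/-- The `G`-space `E` has a countable `G`-invariant partition of unity with local trivializations
of the action over the sets where its members are nonzero. -/
def IsNumerableSpace (G : Type*) [Group G] (E : Type*) [TopologicalSpace E] [MulAction G E] :
    Prop :=
  ∃ (ρ : ℕ → E → ℝ) (γ : ℕ → E → G), (∀ n, Continuous (ρ n)) ∧ (∀ n y, 0 ≤ ρ n y) ∧
    (∀ n (g : G) y, ρ n (g • y) = ρ n y) ∧ (LocallyFinite fun n => support (ρ n)) ∧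
    (∀ y, ∑ᶠ n, ρ n y = 1) ∧ (∀ n g y, ρ n y ≠ 0 → γ n (g • y) = g * γ n y) ∧
    ∀ n y, ρ n y ≠ 0 → ∀ᶠ z in 𝓝 y, γ n z = γ n y

section Universal

variable {G : Type*} [Group G] {E : Type*} [TopologicalSpace E] [MulAction G E]

/-- The partition of unity is pulled back to `E`. Since `ρ n ≠ 0` is an open condition, local
constancy on that subspace is local constancy in `E`. -/
theorem IsUniversalSpace.isNumerableSpace (hE : IsUniversalSpace G E) : IsNumerableSpace G E := by
  obtain ⟨ρ, hρ⟩ := hE.numerable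
  choose γ hγ hγc using hρ
  have hmk : Continuous (Quotient.mk (MulAction.orbitRel G E)) := continuous_quot_mk
  refine ⟨fun n y => ρ n (Quotient.mk _ y), γ, fun n => (ρ n).continuous.comp hmk,
    fun n y => ρ.nonneg n _, fun n g y => ?_, ?_, fun y => ρ.sum_eq_one (Set.mem_univ _), hγ,
    fun n y hy => ?_⟩
  · exact congrArg (ρ n) (Quotient.sound ⟨g, rfl⟩)
  · exact ρ.locallyFinite.preimage_continuous hmk
  · have ho : IsOpen {e : E | ρ n (Quotient.mk _ e) ≠ 0} :=
      isOpen_ne.preimage ((ρ n).continuous.comp hmk)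
    have := (IsLocallyConstant.iff_eventually_eq _).1 (hγc n) ⟨y, hy⟩
    exact ((ho.isOpenEmbedding_subtypeVal.map_nhds_eq ⟨y, hy⟩) ▸ Filter.eventually_map.2 this :
      ∀ᶠ z in 𝓝 y, γ n z = γ n y)

theorem IsNumerableSpace.isUniversalSpace [ContinuousConstSMul G E] [ContractibleSpace E]
    (hE : IsNumerableSpace G E) : IsUniversalSpace G E := by
  obtain ⟨ρ, γ, hρc, hρ, hρG, hfin, hsum, hγ, hγc⟩ := hE
  have hmk := MulAction.isOpenQuotientMap_quotientMk (Γ := G) (T := E)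
  have hlift : ∀ n, ∀ a b : E, MulAction.orbitRel G E a b → ρ n a = ρ n b := by
    rintro n _ b ⟨g, rfl⟩
    exact hρG n g b
  refine ⟨inferInstance, inferInstance,
    ⟨fun n => ⟨Quotient.lift (ρ n) (hlift n), (hρc n).quotient_lift _⟩, ?_, ?_, ?_, ?_⟩, ?_⟩
  · intro x
    obtain ⟨y, rfl⟩ := hmk.surjective x
    obtain ⟨t, ht, hft⟩ := hfin y
    refine ⟨_, hmk.isOpenMap.image_mem_nhds ht, hft.subset ?_⟩
    rintro n ⟨_, hz, z, hzt, rfl⟩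
    exact ⟨z, hz, hzt⟩
  · intro n x
    induction x using Quotient.inductionOn with
    | h y => exact hρ n y
  · intro x _
    induction x using Quotient.inductionOn with
    | h y => exact hsum y
  · intro x
    induction x using Quotient.inductionOn with
    | h y => exact (hsum y).le
  · intro n
    refine ⟨γ n, fun g e he => hγ n g e he, (IsLocallyConstant.iff_eventually_eq _).2 ?_⟩
    intro e
    exact (continuousAt_subtype_val (x := e)).eventually (p := fun z => γ n z = γ n e)
      (hγc n e e.2)

variable {X : Type*} [TopologicalSpace X] [MulAction G X] [ContinuousConstSMul G X]
  [ContractibleSpace X]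

/-- The extension theorem with empty initial domain (`s = 0`), so that the starting map can be any
constant. -/
theorem IsNumerableSpace.exists_equivariant_map (hE : IsNumerableSpace G E) :
    ∃ k : C(E, X), ∀ (g : G) e, k (g • e) = g • k e := by
  obtain ⟨ρ, γ, hρc, hρ, hρG, hfin, hsum, hγ, hγc⟩ := hE
  obtain ⟨x⟩ : Nonempty X := inferInstance
  obtain ⟨k, hk, -⟩ := exists_equivariant_extension (X := X) (s := fun _ => 0) (f := fun _ => x)
    continuous_const (fun _ => le_rfl) (fun _ _ => rfl) (by simp) (by simp) hρc hρ hρG hfin hγ hγc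
    (fun y _ => by
      by_contra! h0
      simpa [h0] using hsum y)
  exact ⟨k, hk⟩

/-- The map equal to `f₀` for `t < 1/2` and to `f₁` for `t > 1/2` is extended across `t = 1/2`,
where `s = |2 t - 1|` vanishes. The factor `t (1 - t)` in the bump functions makes them vanish at
the two ends, so that the values there are kept. -/
theorem IsNumerableSpace.exists_equivariant_homotopy (hE : IsNumerableSpace G E) (f₀ f₁ : C(E, X))
    (h₀ : ∀ (g : G) e, f₀ (g • e) = g • f₀ e) (h₁ : ∀ (g : G) e, f₁ (g • e) = g • f₁ e) :
    ∃ H : C(I × E, X), (∀ e, H (0, e) = f₀ e) ∧ (∀ e, H (1, e) = f₁ e) ∧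
      ∀ (g : G) t e, H (t, g • e) = g • H (t, e) := by
  obtain ⟨ρ, γ, hρc, hρ, hρG, hfin, hsum, hγ, hγc⟩ := hE
  let : MulAction G (I × E) :=
    { smul := fun g p => (p.1, g • p.2)
      one_smul := fun p => Prod.ext rfl (one_smul G p.2)
      mul_smul := fun g k p => Prod.ext rfl (mul_smul g k p.2) }
  have hb : ∀ t : I, 0 ≤ (t : ℝ) * (1 - t) := fun t =>
    mul_nonneg t.2.1 (by linarith [t.2.2])
  obtain ⟨H, hHG, hH⟩ : ∃ H : C(I × E, X), (∀ (g : G) p, H (g • p) = g • H p) ∧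
      ∀ p, (∀ n, (p.1 : ℝ) * (1 - p.1) * ρ n p.2 = 0) →
        H p = if (p.1 : ℝ) < 1 / 2 then f₀ p.2 else f₁ p.2 := by
    refine exists_equivariant_extension (G := G) (Y := I × E) (X := X)
      (s := fun p => |2 * (p.1 : ℝ) - 1|)
      (f := fun p => if (p.1 : ℝ) < 1 / 2 then f₀ p.2 else f₁ p.2)
      (ρ := fun n p => p.1 * (1 - p.1) * ρ n p.2) (γ := fun n p => γ n p.2)
      (by fun_prop) (fun _ => abs_nonneg _) (fun _ _ => rfl) ?_ ?_ (by fun_prop)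
      (fun n p => mul_nonneg (hb _) (hρ n _)) (fun n g p => congrArg (_ * ·) (hρG n g p.2))
      ?_ (fun n g p hp => hγ n g p.2 (right_ne_zero_of_mul hp)) ?_ ?_
    · intro p hp
      rcases lt_trichotomy (p.1 : ℝ) (1 / 2) with h | h | h
      · refine (f₀.continuous.comp continuous_snd).continuousAt.congr ?_
        filter_upwards [(isOpen_lt (by fun_prop) continuous_const :
          IsOpen {q : I × E | (q.1 : ℝ) < 1 / 2}).mem_nhds h] with q (hq : (q.1 : ℝ) < 1 / 2)
        simp only [if_pos hq]
        rfl
      · simp [h] at hp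
      · refine (f₁.continuous.comp continuous_snd).continuousAt.congr ?_
        filter_upwards [(isOpen_lt continuous_const (by fun_prop) :
          IsOpen {q : I × E | 1 / 2 < (q.1 : ℝ)}).mem_nhds h] with q (hq : 1 / 2 < (q.1 : ℝ))
        simp only [if_neg hq.not_gt]
        rfl
    · intro g p _
      change (if (p.1 : ℝ) < 1 / 2 then f₀ (g • p.2) else f₁ (g • p.2)) = _
      rw [h₀, h₁, smul_ite]
    · refine (hfin.preimage_continuous (continuous_snd (X := I))).subset ?_
      intro n p hp
      exact right_ne_zero_of_mul hp
    · intro n p hp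
      exact continuous_snd.continuousAt.eventually (hγc n p.2 (right_ne_zero_of_mul hp))
    · intro p hp
      have hp' : (p.1 : ℝ) = 1 / 2 := by linarith [abs_eq_zero.1 hp]
      obtain ⟨n, hn⟩ : ∃ n, ρ n p.2 ≠ 0 := by
        by_contra! h0
        simpa [h0] using hsum p.2
      exact ⟨n, by simp only [hp']; exact mul_ne_zero (by norm_num) hn⟩
  refine ⟨H, fun e => ?_, fun e => ?_, fun g t e => hHG g (t, e)⟩
  · rw [hH _ (by simp)]
    simp
  · rw [hH _ (by simp)]
    norm_num

end Universal

/-! ### Homotopy equivalences of pairs -/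

namespace Cohomology

variable (F : OmegaSpectrum.{v}) (n : ℤ) {X X' : Type*} [TopologicalSpace X] [TopologicalSpace X']
  {Y : Set X} {Y' : Set X'}

/-- Addition is pointwise concatenation in the target, and pulling back is precomposition, so the
two commute already on representatives. -/
theorem pull_add (k : C(X, X')) (hk : ∀ y ∈ Y, k y ∈ Y') (a b : Cohomology F n X' Y') :
    pull F n k hk (a + b) = pull F n k hk a + pull F n k hk b := by
  have hloop : ∀ a : Cohomology F n X' Y', loopEquiv F n X Y (pull F n k hk a) =
      PairClass.pull _ _ k hk (loopEquiv F n X' Y' a) := by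
    intro a
    induction a using Quotient.inductionOn with
    | h f => rfl
  apply (loopEquiv F n X Y).injective
  rw [loopEquiv_add, hloop, hloop, hloop, loopEquiv_add]
  generalize loopEquiv F n X' Y' a = a
  generalize loopEquiv F n X' Y' b = b
  induction a using Quotient.inductionOn with
  | h f =>
  induction b using Quotient.inductionOn with
  | h g => rfl

theorem pull_pull_eq (k : C(X, X')) (l : C(X', X)) (hk : ∀ y ∈ Y, k y ∈ Y')
    (hl : ∀ y ∈ Y', l y ∈ Y) (H : C(I × X, X)) (h0 : ∀ x, H (0, x) = l (k x))
    (h1 : ∀ x, H (1, x) = x) (hY : ∀ t, ∀ y ∈ Y, H (t, y) ∈ Y) (a : Cohomology F n X Y) :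
    pull F n k hk (pull F n l hl a) = a := by
  induction a using Quotient.inductionOn with
  | h f =>
  exact Quotient.sound (PairClass.homotopicRel_of (fun p => f.1 (H p)) (by fun_prop)
    (fun x => by simp [h0]) (fun x => by simp [h1]) fun t y hy => f.2 _ (hY t y hy))

end Cohomology

/-- Homotopy equivalences of pairs `(X, Y) ≃ (X', Y')`. -/
structure PairHomotopyEquiv {X X' : Type*} [TopologicalSpace X] [TopologicalSpace X']
    (Y : Set X) (Y' : Set X') where
  toMap : C(X, X')
  invMap : C(X', X)
  toMap_mem : ∀ y ∈ Y, toMap y ∈ Y'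
  invMap_mem : ∀ y ∈ Y', invMap y ∈ Y
  left : C(I × X, X)
  left_zero : ∀ x, left (0, x) = invMap (toMap x)
  left_one : ∀ x, left (1, x) = x
  left_mem : ∀ t, ∀ y ∈ Y, left (t, y) ∈ Y
  right : C(I × X', X')
  right_zero : ∀ x, right (0, x) = toMap (invMap x)
  right_one : ∀ x, right (1, x) = x
  right_mem : ∀ t, ∀ y ∈ Y', right (t, y) ∈ Y'

namespace PairHomotopyEquiv

variable {X X' : Type*} [TopologicalSpace X] [TopologicalSpace X'] {Y : Set X} {Y' : Set X'}

/-- Homotopy equivalent pairs have isomorphic cohomology. -/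
def cohomologyEquiv (e : PairHomotopyEquiv Y Y') (F : OmegaSpectrum.{v}) (n : ℤ) :
    Cohomology F n X Y ≃+ Cohomology F n X' Y' where
  toFun := Cohomology.pull F n e.invMap e.invMap_mem
  invFun := Cohomology.pull F n e.toMap e.toMap_mem
  left_inv := Cohomology.pull_pull_eq F n _ _ _ _ e.left e.left_zero e.left_one e.left_mem
  right_inv := Cohomology.pull_pull_eq F n _ _ _ _ e.right e.right_zero e.right_one e.right_mem
  map_add' := Cohomology.pull_add F n _ _

/-- The underlying homotopy equivalence of spaces. -/
def toHomotopyEquiv (e : PairHomotopyEquiv Y Y') : ContinuousMap.HomotopyEquiv X X' where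
  toFun := e.toMap
  invFun := e.invMap
  left_inv := ⟨⟨e.left, e.left_zero, e.left_one⟩⟩
  right_inv := ⟨⟨e.right, e.right_zero, e.right_one⟩⟩

/-- A homeomorphism of pairs. -/
def ofHomeomorph (e : X ≃ₜ X') (h : ∀ x, e x ∈ Y' ↔ x ∈ Y) : PairHomotopyEquiv Y Y' where
  toMap := e
  invMap := e.symm
  toMap_mem y := (h y).2
  invMap_mem y hy := (h _).1 (by simpa using hy)
  left := ContinuousMap.snd
  left_zero := by simp
  left_one _ := rfl
  left_mem _ _ hy := hy
  right := ContinuousMap.snd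
  right_zero := by simp
  right_one _ := rfl
  right_mem _ _ hy := hy

end PairHomotopyEquiv

/-! ### Orbit spaces -/

namespace OrbitSpace

variable {G : Type*} [Group G] {A B : Type*} [TopologicalSpace A] [TopologicalSpace B]
  [MulAction G A] [MulAction G B]

/-- The map of orbit spaces induced by an equivariant map. -/
def map (k : C(A, B)) (hk : ∀ (g : G) a, k (g • a) = g • k a) :
    C(OrbitSpace G A, OrbitSpace G B) where
  toFun := Quotient.map k (by
    rintro _ a ⟨g, rfl⟩
    exact ⟨g, (hk g a).symm⟩)
  continuous_toFun := k.continuous.quotient_map' _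

/-- The homotopy on orbit spaces induced by an equivariant homotopy. -/
def homotopy [ContinuousConstSMul G A] (K : C(I × A, B))
    (hK : ∀ (g : G) t a, K (t, g • a) = g • K (t, a)) : C(I × OrbitSpace G A, OrbitSpace G B) where
  toFun p := Quotient.map (fun a => K (p.1, a)) (by
    rintro _ a ⟨g, rfl⟩
    exact ⟨g, (hK g p.1 a).symm⟩) p.2
  continuous_toFun := by
    -- The orbit map is open, so its product with the identity of `I` is again a quotient map and
    -- continuity can be tested on `I × A`.
    rw [((IsOpenQuotientMap.id (X := I)).prodMap
      (MulAction.isOpenQuotientMap_quotientMk (Γ := G) (T := A))).isQuotientMap.continuous_iff]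
    exact (continuous_quot_mk (r := (MulAction.orbitRel G B))).comp K.continuous

/-- An equivariant homotopy equivalence of pairs induces a homotopy equivalence of the pairs of
orbit spaces. -/
def pairHomotopyEquiv [ContinuousConstSMul G A] [ContinuousConstSMul G B] {S : Set A} {T : Set B}
    (e : PairHomotopyEquiv S T) (hk : ∀ (g : G) a, e.toMap (g • a) = g • e.toMap a)
    (hl : ∀ (g : G) a, e.invMap (g • a) = g • e.invMap a)
    (hK : ∀ (g : G) t a, e.left (t, g • a) = g • e.left (t, a))
    (hL : ∀ (g : G) t a, e.right (t, g • a) = g • e.right (t, a)) :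
    PairHomotopyEquiv (X := OrbitSpace G A) (X' := OrbitSpace G B)
      (Quotient.mk _ '' S) (Quotient.mk _ '' T) where
  toMap := map e.toMap hk
  invMap := map e.invMap hl
  toMap_mem := by
    rintro _ ⟨a, ha, rfl⟩
    exact ⟨_, e.toMap_mem a ha, rfl⟩
  invMap_mem := by
    rintro _ ⟨a, ha, rfl⟩
    exact ⟨_, e.invMap_mem a ha, rfl⟩
  left := homotopy e.left hK
  left_zero x := by
    induction x using Quotient.inductionOn with
    | h a => exact congrArg (Quotient.mk _) (e.left_zero a)
  left_one x := by
    induction x using Quotient.inductionOn with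
    | h a => exact congrArg (Quotient.mk _) (e.left_one a)
  left_mem := by
    rintro t _ ⟨a, ha, rfl⟩
    exact ⟨_, e.left_mem t a ha, rfl⟩
  right := homotopy e.right hL
  right_zero x := by
    induction x using Quotient.inductionOn with
    | h a => exact congrArg (Quotient.mk _) (e.right_zero a)
  right_one x := by
    induction x using Quotient.inductionOn with
    | h a => exact congrArg (Quotient.mk _) (e.right_one a)
  right_mem := by
    rintro t _ ⟨a, ha, rfl⟩
    exact ⟨_, e.right_mem t a ha, rfl⟩

/-- An open quotient map that matches the orbits of two group actions induces a homeomorphism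
of the orbit spaces. -/
def homeomorph {P : Type*} [Group P] {C : Type*} [TopologicalSpace C] [MulAction P C]
    [ContinuousConstSMul P C] (q : A → C) (hq : IsOpenQuotientMap q)
    (h : ∀ a b : A, (∃ p : P, p • q b = q a) ↔ ∃ g : G, g • b = a) :
    OrbitSpace G A ≃ₜ OrbitSpace P C :=
  have hc : IsOpenQuotientMap fun a => Quotient.mk (MulAction.orbitRel P C) (q a) :=
    MulAction.isOpenQuotientMap_quotientMk.comp hq
  let f : OrbitSpace G A → OrbitSpace P C :=
    Quotient.map q fun a b hab => (h a b).2 hab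
  have hf : IsOpenQuotientMap f :=
    .of_comp continuous_quot_mk Quot.mk_surjective (hq.continuous.quotient_map' _) hc
  IsHomeomorph.homeomorph f ⟨hf.continuous, hf.isOpenMap, by
    refine fun x y => Quotient.inductionOn₂ x y fun a b hab => ?_
    exact Quotient.sound ((h a b).1 (Quotient.exact hab)), hf.surjective⟩

/-- An orbit lies in the image of `T` as soon as it meets `T`; no invariance of `S` or `T` is
required. -/
theorem homeomorph_mem_iff {P : Type*} [Group P] {C : Type*} [TopologicalSpace C] [MulAction P C]
    [ContinuousConstSMul P C] (q : A → C) (hq : IsOpenQuotientMap q)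
    (h : ∀ a b : A, (∃ p : P, p • q b = q a) ↔ ∃ g : G, g • b = a) {S : Set A} {T : Set C}
    (hST : ∀ a, q a ∈ T ↔ a ∈ S) (x : OrbitSpace G A) :
    homeomorph q hq h x ∈ (Quotient.mk (MulAction.orbitRel P C)) '' T ↔
      x ∈ (Quotient.mk (MulAction.orbitRel G A)) '' S := by
  induction x using Quotient.inductionOn with
  | h a =>
  constructor
  · rintro ⟨c, hc, hca⟩
    obtain ⟨b, rfl⟩ := hq.surjective c
    obtain ⟨g, rfl⟩ := (h b a).1 (Quotient.exact hca)
    exact ⟨_, (hST _).1 hc, Quotient.sound ⟨g, rfl⟩⟩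
  · rintro ⟨b, hb, hba⟩
    exact ⟨q b, (hST b).2 hb, Quotient.sound ((h b a).2 (Quotient.exact hba))⟩

end OrbitSpace

/-! ### Independence of the model of `EG` -/

section Universal

variable {G : Type*} [Group G] {E₁ E₂ : Type*} [TopologicalSpace E₁] [TopologicalSpace E₂]
  [MulAction G E₁] [MulAction G E₂]

/-- Existence gives equivariant maps both ways, and uniqueness up to homotopy makes their composites
homotopic to the identities. The equivalence is kept upstairs, before passing to orbits, so that its
product with any `G`-space can be formed. -/
theorem IsUniversalSpace.exists_equivariant_pairHomotopyEquiv (h₁ : IsUniversalSpace G E₁)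
    (h₂ : IsUniversalSpace G E₂) :
    ∃ e : PairHomotopyEquiv (∅ : Set E₁) (∅ : Set E₂),
      (∀ (g : G) a, e.toMap (g • a) = g • e.toMap a) ∧
      (∀ (g : G) a, e.invMap (g • a) = g • e.invMap a) ∧
      (∀ (g : G) t a, e.left (t, g • a) = g • e.left (t, a)) ∧
      ∀ (g : G) t a, e.right (t, g • a) = g • e.right (t, a) := by
  have := h₁.contractible
  have := h₂.contractible
  have := h₁.continuous_smul
  have := h₂.continuous_smul
  obtain ⟨k, hk⟩ := h₁.isNumerableSpace.exists_equivariant_map (X := E₂)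
  obtain ⟨l, hl⟩ := h₂.isNumerableSpace.exists_equivariant_map (X := E₁)
  obtain ⟨K, hK0, hK1, hK⟩ := h₁.isNumerableSpace.exists_equivariant_homotopy (l.comp k) (.id _)
    (by simp [hk, hl]) (by simp)
  obtain ⟨L, hL0, hL1, hL⟩ := h₂.isNumerableSpace.exists_equivariant_homotopy (k.comp l) (.id _)
    (by simp [hk, hl]) (by simp)
  exact ⟨⟨k, l, by simp, by simp, K, hK0, hK1, by simp, L, hL0, hL1, by simp⟩, hk, hl, hK, hL⟩

/-- Two models of `EG` have homotopy equivalent orbit spaces. -/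
theorem IsUniversalSpace.nonempty_homotopyEquiv (h₁ : IsUniversalSpace G E₁)
    (h₂ : IsUniversalSpace G E₂) :
    Nonempty (ContinuousMap.HomotopyEquiv (OrbitSpace G E₁) (OrbitSpace G E₂)) := by
  have := h₁.continuous_smul
  have := h₂.continuous_smul
  obtain ⟨e, hk, hl, hK, hL⟩ := h₁.exists_equivariant_pairHomotopyEquiv h₂
  exact ⟨(OrbitSpace.pairHomotopyEquiv e hk hl hK hL).toHomotopyEquiv⟩

/-- Borel equivariant cohomology does not depend on the model of `EG`. -/
theorem IsUniversalSpace.nonempty_equivariantCohomology_equiv (h₁ : IsUniversalSpace G E₁)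
    (h₂ : IsUniversalSpace G E₂) (F : OmegaSpectrum.{v}) (n : ℤ) (X : Type*) [TopologicalSpace X]
    [MulAction G X] [ContinuousConstSMul G X] (Y : Set X) :
    Nonempty (EquivariantCohomology F G n E₁ X Y ≃+ EquivariantCohomology F G n E₂ X Y) := by
  have := h₁.continuous_smul
  have := h₂.continuous_smul
  obtain ⟨e, hk, hl, hK, hL⟩ := h₁.exists_equivariant_pairHomotopyEquiv h₂
  let e' : PairHomotopyEquiv {q : E₁ × X | q.2 ∈ Y} {q : E₂ × X | q.2 ∈ Y} :=
    { toMap := ⟨fun q => (e.toMap q.1, q.2), by fun_prop⟩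
      invMap := ⟨fun q => (e.invMap q.1, q.2), by fun_prop⟩
      toMap_mem := fun _ hq => hq
      invMap_mem := fun _ hq => hq
      left := ⟨fun p => (e.left (p.1, p.2.1), p.2.2), by fun_prop⟩
      left_zero := fun q => Prod.ext (e.left_zero q.1) rfl
      left_one := fun q => Prod.ext (e.left_one q.1) rfl
      left_mem := fun _ _ hq => hq
      right := ⟨fun p => (e.right (p.1, p.2.1), p.2.2), by fun_prop⟩
      right_zero := fun q => Prod.ext (e.right_zero q.1) rfl
      right_one := fun q => Prod.ext (e.right_one q.1) rfl
      right_mem := fun _ _ hq => hq }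
  exact ⟨(OrbitSpace.pairHomotopyEquiv e' (fun g q => Prod.ext (hk g q.1) rfl)
    (fun g q => Prod.ext (hl g q.1) rfl) (fun g t q => Prod.ext (hK g t q.1) rfl)
    (fun g t q => Prod.ext (hL g t q.1) rfl)).cohomologyEquiv F n⟩

/-- The product of a model of `EG` with a contractible `G`-space is a model of `EG`. -/
theorem IsUniversalSpace.prod (h₁ : IsUniversalSpace G E₁) [ContractibleSpace E₂]
    [ContinuousConstSMul G E₂] : IsUniversalSpace G (E₁ × E₂) := by
  have := h₁.contractible
  have := h₁.continuous_smul
  obtain ⟨ρ, γ, hρc, hρ, hρG, hfin, hsum, hγ, hγc⟩ := h₁.isNumerableSpace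
  exact IsNumerableSpace.isUniversalSpace ⟨fun n q => ρ n q.1, fun n q => γ n q.1,
    fun n => (hρc n).comp continuous_fst, fun n q => hρ n q.1, fun n g q => hρG n g q.1,
    hfin.preimage_continuous continuous_fst, fun q => hsum q.1, fun n g q => hγ n g q.1,
    fun n q hq => continuous_fst.continuousAt.eventually (hγc n q.1 hq)⟩

instance TwistedInterval.continuousConstSMul (φ : G →* ℤˣ) :
    ContinuousConstSMul G (TwistedInterval φ) where
  continuous_const_smul g := by
    refine continuous_induced_rng.2 ?_
    change Continuous fun x : unitInterval => 1 / 2 + ((φ g : ℤ) : ℝ) * ((x : ℝ) - 1 / 2)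
    fun_prop

end Universal

/-! ### The real line as a numerable `ℤ`-space -/

/-- The offset of the integer cuts of the real line: `0` or `1/2`. -/
def lineOffset (b : Bool) : ℝ := if b then 1 / 2 else 0

/-- The functions `sin²(π x)` and `cos²(π x)`. -/
def lineBump (b : Bool) (x : ℝ) : ℝ := Real.sin (Real.pi * (x + lineOffset b)) ^ 2

theorem sum_lineBump (x : ℝ) : ∑ b, lineBump b x = 1 := by
  rw [Fintype.sum_bool]
  have : Real.pi * (x + 1 / 2) = Real.pi * x + Real.pi / 2 := by ring
  simp only [lineBump, lineOffset, if_true, this, Real.sin_add_pi_div_two]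
  simp

theorem continuous_lineBump (b : Bool) : Continuous (lineBump b) := by
  unfold lineBump
  fun_prop

theorem lineBump_int_add (b : Bool) (m : ℤ) (x : ℝ) : lineBump b (m + x) = lineBump b x := by
  have : Real.pi * (m + x + lineOffset b) = Real.pi * (x + lineOffset b) + m * Real.pi := by ring
  simp only [lineBump, this, Real.sin_add_int_mul_pi, mul_pow]
  rcases Int.even_or_odd m with h | h <;> simp [h.neg_one_zpow]

/-- The bump vanishes at the points where the shifted floor jumps. Thus the floor, which commutes
with integer translations, is a local trivialization of the `ℤ`-action on the line. -/
theorem eventually_floor_eq_of_lineBump_ne_zero {b : Bool} {x : ℝ} (hx : lineBump b x ≠ 0) :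
    ∀ᶠ z in 𝓝 x, ⌊z + lineOffset b⌋ = ⌊x + lineOffset b⌋ := by
  have hne : (⌊x + lineOffset b⌋ : ℝ) ≠ x + lineOffset b := by
    intro h
    apply hx
    rw [lineBump, ← h, mul_comm, Real.sin_int_mul_pi]
    simp
  have hlt : (⌊x + lineOffset b⌋ : ℝ) < x + lineOffset b := (Int.floor_le _).lt_of_ne hne
  have hc : ContinuousAt (fun z : ℝ => z + lineOffset b) x := by fun_prop
  filter_upwards [hc.eventually_const_lt hlt,
    hc.eventually_lt_const (Int.lt_floor_add_one _)] with z h1 h2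
  exact Int.floor_eq_iff.2 ⟨h1.le, h2⟩

/-! ### Discrete subgroups of a Euclidean space -/

/-- Coordinates on a Euclidean space that restrict to coordinates of a discrete subgroup. -/
theorem Submodule.exists_integral_coordinates {E : Type*} [NormedAddCommGroup E] [NormedSpace ℝ E]
    [FiniteDimensional ℝ E] (L : Submodule ℤ E) [DiscreteTopology L] :
    ∃ (ι : Type) (_ : Fintype ι) (c : E →ₗ[ℝ] ι → ℝ) (β : (ι → ℤ) →+ L),
      ∀ x : L, ∃ m : ι → ℤ, (∀ i, c x i = m i) ∧ β m = x := by
  -- `L` need not span `E`. Inside its real span it is a lattice, and a `ℤ`-basis of it is a real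
  -- basis of the span.
  let f := (Submodule.span ℝ (L : Set E)).subtype
  let L₀ := L.comap (f.restrictScalars ℤ)
  have h_img : f '' L₀ = L := by
    rw [← LinearMap.coe_restrictScalars ℤ f, ← Submodule.map_coe (f.restrictScalars ℤ),
      Submodule.map_comap_eq_self]
    exact fun x hx ↦ LinearMap.mem_range.mpr ⟨⟨x, Submodule.subset_span hx⟩, rfl⟩
  have : DiscreteTopology L₀ := by
    refine DiscreteTopology.preimage_of_continuous_injective (L : Set E) ?_
      (Submodule.injective_subtype _)
    exact LinearMap.continuous_of_finiteDimensional f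
  have : IsZLattice ℝ L₀ := ⟨by
    rw [← (Submodule.map_injective_of_injective (Submodule.injective_subtype _)).eq_iff,
      Submodule.map_span, Submodule.map_top, Submodule.range_subtype, h_img]⟩
  have b := (Module.finBasis ℤ L₀)
  -- The coordinates on the span are extended linearly, in any way, to the whole of `E`; only their
  -- values on `L` are prescribed.
  obtain ⟨c, hc⟩ := LinearMap.exists_extend (b.ofZLatticeBasis ℝ L₀).equivFun.toLinearMap
  refine ⟨_, inferInstance, c, ?_, ?_⟩
  · exact (((f.restrictScalars ℤ).restrict (p := L₀) (q := L) fun _ hx => hx).comp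
      b.equivFun.symm.toLinearMap).toAddMonoidHom
  · intro x
    let x₀ : L₀ := ⟨⟨x, Submodule.subset_span x.2⟩, x.2⟩
    refine ⟨b.repr x₀, fun i => ?_, ?_⟩
    · have h1 := congrFun (LinearMap.congr_fun hc x₀.1) i
      refine h1.trans ?_
      exact b.ofZLatticeBasis_repr_apply ℝ L₀ x₀ i
    · have : b.equivFun.symm (b.repr x₀) = x₀ := b.equivFun.symm_apply_apply x₀
      change (f.restrictScalars ℤ).restrict (p := L₀) (q := L) (fun _ hx => hx)
        (b.equivFun.symm (b.repr x₀)) = x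
      rw [this]
      rfl

/-- A discrete subgroup of a Euclidean space acts on it with a finite invariant partition of
unity and local trivializations. -/
theorem Submodule.exists_finite_trivialization {E : Type*} [NormedAddCommGroup E] [NormedSpace ℝ E]
    [FiniteDimensional ℝ E] (L : Submodule ℤ E) [DiscreteTopology L] :
    ∃ (κ : Type) (_ : Fintype κ) (η : κ → E → ℝ) (δ : κ → E → L),
      (∀ j, Continuous (η j)) ∧ (∀ j v, 0 ≤ η j v) ∧ (∀ j (x : L) v, η j (x + v) = η j v) ∧
      (∀ v, ∑ j, η j v = 1) ∧ (∀ j (x : L) v, δ j (x + v) = x + δ j v) ∧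
      ∀ j v, η j v ≠ 0 → ∀ᶠ z in 𝓝 v, δ j z = δ j v := by
  classical
  obtain ⟨ι, _, c, β, hβ⟩ := L.exists_integral_coordinates
  have hc : Continuous c := c.continuous_of_finiteDimensional
  -- One of the two bumps is chosen in each coordinate. Expanding `∏ i, (sin² + cos²) = 1` shows
  -- that these products sum to `1`.
  refine ⟨ι → Bool, inferInstance, fun j v => ∏ i, lineBump (j i) (c v i),
    fun j v => β fun i => ⌊c v i + lineOffset (j i)⌋, fun j => ?_, fun j v => ?_, fun j x v => ?_,
    fun v => ?_, fun j x v => ?_, fun j v hv => ?_⟩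
  · exact continuous_finsetProd _ fun i _ => (continuous_lineBump _).comp (by fun_prop)
  · exact Finset.prod_nonneg fun i _ => sq_nonneg _
  · obtain ⟨m, hm, -⟩ := hβ x
    simp only [map_add, Pi.add_apply, hm, lineBump_int_add]
  · have := Finset.prod_univ_sum (fun _ : ι => (Finset.univ : Finset Bool))
      fun i b => lineBump b (c v i)
    simp only [sum_lineBump, Finset.prod_const_one, Fintype.piFinset_univ] at this
    exact this.symm
  · obtain ⟨m, hm, hx⟩ := hβ x
    simp only [map_add, Pi.add_apply, hm, add_assoc, Int.floor_intCast_add]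
    rw [← hx, ← map_add]
    rfl
  · have h1 : ∀ i, ∀ᶠ z in 𝓝 v, ⌊c z i + lineOffset (j i)⌋ = ⌊c v i + lineOffset (j i)⌋ :=
      fun i => (by fun_prop : Continuous fun z => c z i).continuousAt.eventually
        (eventually_floor_eq_of_lineBump_ne_zero fun h0 =>
          hv (Finset.prod_eq_zero (Finset.mem_univ i) h0))
    filter_upwards [eventually_all.2 h1] with z hz
    simp only [hz]

/-! ### The universal spaces of a space group -/

section SpaceGroup

variable {d : ℕ} {G : Subgroup (EucGroup d)}

instance : ContinuousConstSMul (EucGroup d) (Euc d) :=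
  ⟨fun g => AffineIsometryEquiv.continuous g⟩

instance : ContinuousConstSMul G (Euc d) :=
  ⟨fun g => AffineIsometryEquiv.continuous (g : EucGroup d)⟩

instance : ContinuousConstSMul (translationGroup G) (Euc d) :=
  ⟨fun t => AffineIsometryEquiv.continuous ((t : G) : EucGroup d)⟩

theorem translationGroup_smul (t : translationGroup G) (v : Euc d) :
    t • v = t • (0 : Euc d) + v := by
  have h1 : EucGroup.linear d ((t : G) : EucGroup d) = 1 := congrArg Subtype.val t.2
  have h2 := ((t : G) : EucGroup d).map_vadd 0 v
  change _ = (EucGroup.linear d ((t : G) : EucGroup d)) v +ᵥ _ at h2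
  rw [h1] at h2
  simp only [vadd_eq_add, add_zero] at h2
  exact h2.trans (add_comm _ _)

theorem translationGroup_ext {s t : translationGroup G} (h : s • (0 : Euc d) = t • (0 : Euc d)) :
    s = t := by
  refine Subtype.ext (Subtype.ext (AffineIsometryEquiv.ext fun v => ?_))
  change s • v = t • v
  rw [translationGroup_smul, h, ← translationGroup_smul]

variable (G) in
/-- The translation vectors of the elements of `Π`. -/
def translationLattice : Submodule ℤ (Euc d) :=
  AddSubgroup.toIntSubmodule
    { carrier := Set.range fun t : translationGroup G => t • (0 : Euc d)
      add_mem' := by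
        rintro _ _ ⟨s, rfl⟩ ⟨t, rfl⟩
        exact ⟨s * t, by simp only [mul_smul]; exact translationGroup_smul s _⟩
      zero_mem' := ⟨1, one_smul _ _⟩
      neg_mem' := by
        rintro _ ⟨t, rfl⟩
        refine ⟨t⁻¹, ?_⟩
        have := translationGroup_smul t (t⁻¹ • (0 : Euc d))
        rw [smul_inv_smul] at this
        exact (neg_eq_of_add_eq_zero_right this.symm).symm }

/-- Proper discontinuity, applied to the compact sets `{0}` and the closed unit ball, leaves only
finitely many translation vectors in the ball. Removing the nonzero ones from the open ball isolates
`0`. -/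
theorem IsSpaceGroup.discreteTopology_translationLattice (hG : IsSpaceGroup G) :
    DiscreteTopology (translationLattice G) := by
  have := hG.properlyDiscontinuous
  refine discreteTopology_of_isOpen_singleton_zero ?_
  have hfin : ((translationLattice G : Set (Euc d)) ∩ Metric.closedBall 0 1).Finite := by
    refine ((ProperlyDiscontinuousSMul.finite_disjoint_inter_image (Γ := G)
      (isCompact_singleton (x := (0 : Euc d))) (isCompact_closedBall (0 : Euc d) 1)).image
      fun g => g • (0 : Euc d)).subset ?_
    rintro _ ⟨⟨t, rfl⟩, ht⟩
    exact ⟨t, ⟨_, ⟨0, rfl, rfl⟩, ht⟩, rfl⟩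
  have hopen : IsOpen (Metric.ball (0 : Euc d) 1 \
      (((translationLattice G : Set (Euc d)) ∩ Metric.closedBall 0 1) \ {0})) :=
    Metric.isOpen_ball.sdiff (hfin.subset Set.sdiff_subset).isClosed
  convert hopen.preimage (continuous_subtype_val (p := (· ∈ translationLattice G))) using 1
  ext x
  constructor
  · rintro rfl
    simp
  · rintro ⟨h1, h2⟩
    by_contra h3
    exact h2 ⟨⟨x.2, Metric.ball_subset_closedBall h1⟩, fun h4 => h3 (Subtype.ext h4)⟩

/-- A finite invariant partition of unity with local trivializations for the action of `Π`. -/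
theorem IsSpaceGroup.exists_finite_trivialization (hG : IsSpaceGroup G) :
    ∃ (κ : Type) (_ : Fintype κ) (η : κ → Euc d → ℝ) (δ : κ → Euc d → translationGroup G),
      (∀ j, Continuous (η j)) ∧ (∀ j v, 0 ≤ η j v) ∧
      (∀ j (t : translationGroup G) v, η j (t • v) = η j v) ∧
      (∀ v, ∑ j, η j v = 1) ∧ (∀ j (t : translationGroup G) v, δ j (t • v) = t * δ j v) ∧
      ∀ j v, η j v ≠ 0 → ∀ᶠ z in 𝓝 v, δ j z = δ j v := by
  have := hG.discreteTopology_translationLattice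
  obtain ⟨κ, _, η, δ, hηc, hη, hηG, hsum, hδ, hδc⟩ :=
    (translationLattice G).exists_finite_trivialization
  have hlift : ∀ x : translationLattice G, ∃ t : translationGroup G, t • (0 : Euc d) = x :=
    fun x => x.2
  choose τ hτ using hlift
  let ν : translationGroup G → translationLattice G := fun t => ⟨t • (0 : Euc d), t, rfl⟩
  refine ⟨κ, inferInstance, η, fun j v => τ (δ j v), hηc, hη, fun j t v => ?_, hsum,
    fun j t v => ?_, fun j v hv => (hδc j v hv).mono fun z hz => congrArg τ hz⟩
  · rw [translationGroup_smul]
    exact hηG j (ν t) v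
  -- A translation is determined by where it sends `0`, so equivariance becomes an identity between
  -- vectors.
  · apply translationGroup_ext
    rw [mul_smul, hτ, hτ, translationGroup_smul t v, translationGroup_smul t (δ j v : Euc d)]
    exact congrArg Subtype.val (hδ j (ν t) v)

/-- Reindexing by the natural numbers a countable partition of unity with trivializations. -/
theorem IsNumerableSpace.of_countable {G E κ : Type*} [Group G] [TopologicalSpace E]
    [MulAction G E] [Countable κ] {ρ : κ → E → ℝ} {γ : κ → E → G} (hρc : ∀ j, Continuous (ρ j))
    (hρ : ∀ j y, 0 ≤ ρ j y) (hρG : ∀ j (g : G) y, ρ j (g • y) = ρ j y)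
    (hfin : LocallyFinite fun j => support (ρ j)) (hsum : ∀ y, ∑ᶠ j, ρ j y = 1)
    (hγ : ∀ j g y, ρ j y ≠ 0 → γ j (g • y) = g * γ j y)
    (hγc : ∀ j y, ρ j y ≠ 0 → ∀ᶠ z in 𝓝 y, γ j z = γ j y) : IsNumerableSpace G E := by
  obtain ⟨e, he⟩ := exists_injective_nat κ
  have hcases : ∀ n, (∃ j, e j = n ∧ extend e ρ 0 n = ρ j ∧ extend e γ 1 n = γ j) ∨
      ((∀ j, e j ≠ n) ∧ extend e ρ 0 n = 0) := by
    intro n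
    by_cases h : ∃ j, e j = n
    · obtain ⟨j, rfl⟩ := h
      exact .inl ⟨j, rfl, he.extend_apply _ _ _, he.extend_apply _ _ _⟩
    · exact .inr ⟨not_exists.1 h, extend_apply' _ _ _ h⟩
  -- Unused indices receive the zero function. The default `1` for the trivialization is immaterial,
  -- being constrained only where the function is nonzero.
  refine ⟨extend e ρ 0, extend e γ 1, fun n => ?_, fun n => ?_, fun n => ?_, ?_, fun y => ?_,
    fun n => ?_, fun n => ?_⟩
  · rcases hcases n with ⟨j, -, h, -⟩ | ⟨-, h⟩ <;> rw [h]
    exacts [hρc j, continuous_const]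
  · rcases hcases n with ⟨j, -, h, -⟩ | ⟨-, h⟩ <;> rw [h]
    exacts [hρ j, fun _ => le_rfl]
  · rcases hcases n with ⟨j, -, h, -⟩ | ⟨-, h⟩ <;> rw [h]
    exacts [hρG j, fun _ _ => rfl]
  · intro y
    obtain ⟨t, ht, hft⟩ := hfin y
    refine ⟨t, ht, (hft.image e).subset ?_⟩
    rintro n ⟨z, hz, hzt⟩
    rcases hcases n with ⟨j, rfl, h, -⟩ | ⟨-, h⟩
    · exact ⟨j, ⟨z, by simpa [h] using hz, hzt⟩, rfl⟩
    · simp [h] at hz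
  · rw [← hsum y, ← finsum_mem_univ, ← finsum_mem_inter_support_eq' _ (Set.range e) Set.univ ?_,
      finsum_mem_range he]
    · simp only [he.extend_apply]
    · intro n hn
      rcases hcases n with ⟨j, rfl, -, -⟩ | ⟨-, h⟩
      · simp
      · simp [h] at hn
  · rcases hcases n with ⟨j, -, h, h'⟩ | ⟨-, h⟩
    · rw [h, h']
      exact hγ j
    · simp [h]
  · rcases hcases n with ⟨j, -, h, h'⟩ | ⟨-, h⟩
    · rw [h, h']
      exact hγc j
    · simp [h]

/-- `ℝ^d` is a model of `EΠ`. -/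
theorem IsSpaceGroup.isUniversalSpace_translationGroup (hG : IsSpaceGroup G) :
    IsUniversalSpace (translationGroup G) (Euc d) := by
  obtain ⟨κ, _, η, δ, hηc, hη, hηG, hsum, hδ, hδc⟩ := hG.exists_finite_trivialization
  exact (IsNumerableSpace.of_countable hηc hη hηG (locallyFinite_of_finite _)
    (fun v => (finsum_eq_sum_of_fintype _).trans (hsum v)) (fun j t v _ => hδ j t v)
    hδc).isUniversalSpace

/-- A `G`-space numerably trivialized over the point group becomes numerable after taking the
product with `ℝ^d`. -/
theorem IsSpaceGroup.isNumerableSpace_prod (hG : IsSpaceGroup G) {Y : Type*} [TopologicalSpace Y]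
    [MulAction G Y] {ρ : ℕ → Y → ℝ} {γ : ℕ → Y → pointGroup G} (hρc : ∀ n, Continuous (ρ n))
    (hρ : ∀ n y, 0 ≤ ρ n y) (hρG : ∀ n (g : G) y, ρ n (g • y) = ρ n y)
    (hfin : LocallyFinite fun n => support (ρ n)) (hρsum : ∀ y, ∑ᶠ n, ρ n y = 1)
    (hγ : ∀ n (g : G) y, ρ n y ≠ 0 → γ n (g • y) = pointProj G g * γ n y)
    (hγc : ∀ n y, ρ n y ≠ 0 → ∀ᶠ z in 𝓝 y, γ n z = γ n y) : IsNumerableSpace G (Euc d × Y) := by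
  obtain ⟨κ, _, η, δ, hηc, hη, hηG, hsum, hδ, hδc⟩ := hG.exists_finite_trivialization
  -- `l` is a set-theoretic section of `π`; its failure to be a homomorphism is measured by the
  -- elements `t` of `Π` below.
  let l := surjInv (pointProj_surjective G)
  have hl : ∀ p, pointProj G (l p) = p := surjInv_eq (pointProj_surjective G)
  have hlt : ∀ (g : G) (p : pointGroup G), ∃ t : translationGroup G,
      l (pointProj G g * p) = g * l p * (t : G) := fun g p =>
    ⟨⟨(g * l p)⁻¹ * l (pointProj G g * p), by simp [MonoidHom.mem_ker, hl]⟩, by simp [mul_assoc]⟩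
  -- With `p = γ y`, the corrected point `(l p)⁻¹ • v` changes under `g` only by `t⁻¹ ∈ Π`. Hence
  -- `η` of it is invariant, and in `l p * δ ((l p)⁻¹ • v)` the factor `t` from `l` cancels the
  -- `t⁻¹` from `δ`, leaving `g` on the left.
  have hfix : ∀ (g : G) (p : pointGroup G) (v : Euc d), ∃ t : translationGroup G,
      l (pointProj G g * p) = g * l p * (t : G) ∧
      (l (pointProj G g * p))⁻¹ • g • v = t⁻¹ • (l p)⁻¹ • v := by
    intro g p v
    obtain ⟨t, ht⟩ := hlt g p
    refine ⟨t, ht, ?_⟩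
    rw [ht]
    change _ = ((t : G)⁻¹) • (l p)⁻¹ • v
    simp only [mul_inv_rev, mul_smul, inv_smul_smul]
  refine IsNumerableSpace.of_countable (κ := ℕ × κ)
    (ρ := fun j q => ρ j.1 q.2 * η j.2 ((l (γ j.1 q.2))⁻¹ • q.1))
    (γ := fun j q => l (γ j.1 q.2) * δ j.2 ((l (γ j.1 q.2))⁻¹ • q.1)) ?_ ?_ ?_ ?_ ?_ ?_ ?_
  · rintro j
    rw [continuous_iff_continuousAt]
    rintro ⟨v, y⟩
    have hy : Continuous fun q : Euc d × Y => ρ j.1 q.2 :=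
      (hρc j.1).comp continuous_snd
    -- Where `ρ` vanishes `γ` is uncontrolled, and continuity comes from the bound `0 ≤ η ≤ 1`;
    -- elsewhere `γ` is locally constant.
    by_cases h0 : ρ j.1 y = 0
    · have hle : ∀ w, η j.2 w ≤ 1 := fun w => (hsum w) ▸
        Finset.single_le_sum (f := fun j => η j w) (fun i _ => hη i w) (Finset.mem_univ j.2)
      have h1 := hy.tendsto (v, y)
      simp only [h0] at h1
      unfold ContinuousAt
      simp only [h0, zero_mul]
      exact squeeze_zero (fun q => mul_nonneg (hρ _ _) (hη _ _))
        (fun q => mul_le_of_le_one_right (hρ _ _) (hle _)) h1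
    · have hγy : ∀ᶠ q : Euc d × Y in 𝓝 (v, y),
          γ j.1 q.2 = γ j.1 y :=
        (continuous_snd.tendsto (v, y)).eventually (hγc j.1 y h0)
      have h1 : Continuous fun q : Euc d × Y =>
          ρ j.1 q.2 * η j.2 ((l (γ j.1 y))⁻¹ • q.1) :=
        hy.mul ((hηc j.2).comp (continuous_fst.const_smul _))
      exact h1.continuousAt.congr (hγy.mono fun q hq => by simp only [hq])
  · exact fun j q => mul_nonneg (hρ _ _) (hη _ _)
  · rintro j g ⟨v, y⟩
    change ρ j.1 (g • y) * η j.2 ((l (γ j.1 (g • y)))⁻¹ • g • v) = ρ j.1 y * _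
    by_cases h0 : ρ j.1 y = 0
    · simp only [hρG, h0, zero_mul]
    · obtain ⟨t, -, ht⟩ := hfix g (γ j.1 y) v
      rw [hγ _ _ _ h0, ht, hηG, hρG]
  · intro q
    obtain ⟨t, ht, hft⟩ := hfin.preimage_continuous
      (continuous_snd (X := Euc d) (Y := Y)) q
    refine ⟨t, ht, (hft.prod (Set.finite_univ (α := κ))).subset ?_⟩
    rintro j ⟨z, hz, hzt⟩
    exact ⟨⟨z, left_ne_zero_of_mul hz, hzt⟩, trivial⟩
  · rintro ⟨v, y⟩
    rw [finsum_curry _ ?_]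
    · refine (finsum_congr fun i => ?_).trans (hρsum y)
      simp only
      rw [finsum_eq_sum_of_fintype, ← Finset.mul_sum, hsum, mul_one]
    · have hy : (support fun n => ρ n y).Finite := hfin.point_finite y
      exact (hy.prod (Set.finite_univ (α := κ))).subset fun j hj =>
        ⟨left_ne_zero_of_mul hj, trivial⟩
  · rintro j g ⟨v, y⟩ hq
    have h0 : ρ j.1 y ≠ 0 := left_ne_zero_of_mul hq
    obtain ⟨t, ht', ht⟩ := hfix g (γ j.1 y) v
    change l (γ j.1 (g • y)) * δ j.2 ((l (γ j.1 (g • y)))⁻¹ • g • v) = g * _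
    rw [hγ _ _ _ h0, ht, hδ, ht']
    simp [mul_assoc]
  · rintro j ⟨v, y⟩ hq
    have hγy : ∀ᶠ q : Euc d × Y in 𝓝 (v, y),
        γ j.1 q.2 = γ j.1 y :=
      (continuous_snd.tendsto (v, y)).eventually (hγc j.1 y (left_ne_zero_of_mul hq))
    have hδy : ∀ᶠ q : Euc d × Y in 𝓝 (v, y),
        δ j.2 ((l (γ j.1 y))⁻¹ • q.1) = δ j.2 ((l (γ j.1 y))⁻¹ • v) :=
      (continuous_fst.const_smul (l (γ j.1 y))⁻¹).continuousAt.eventually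
        (hδc j.2 _ (right_ne_zero_of_mul hq))
    filter_upwards [hγy, hδy] with q h1 h2
    simp only [h1, h2]

/-- `EΠ × EP` is a model of `EG`. -/
theorem IsSpaceGroup.isUniversalSpace_prod (hG : IsSpaceGroup G) {EP : Type*} [TopologicalSpace EP]
    [MulAction (pointGroup G) EP] (hEP : IsUniversalSpace (pointGroup G) EP) :
    IsUniversalSpace G (Euc d × RestrictAlong (pointProj G) EP) := by
  obtain ⟨ρ, γ, hρc, hρ, hρG, hfin, hρsum, hγ, hγc⟩ := hEP.isNumerableSpace
  have : ContractibleSpace (RestrictAlong (pointProj G) EP) := hEP.contractible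
  have hnum : IsNumerableSpace G (Euc d × RestrictAlong (pointProj G) EP) :=
    hG.isNumerableSpace_prod (Y := RestrictAlong (pointProj G) EP) hρc hρ
      (fun n g => hρG n (pointProj G g)) hfin hρsum (fun n g => hγ n (pointProj G g)) hγc
  refine @IsNumerableSpace.isUniversalSpace _ _ _ _ _ ⟨fun g => ?_⟩ inferInstance hnum
  exact (AffineIsometryEquiv.continuous (g : EucGroup d)).prodMap
    (hEP.continuous_smul.continuous_const_smul (pointProj G g))

end SpaceGroup

/-! ### Orbits of `G` on `ℝ^d` against orbits of `P` on `BΠ` -/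

section SpaceGroup

variable {d : ℕ} {G : Subgroup (EucGroup d)}

instance : ContinuousConstSMul (pointGroup G) (BTrans G) where
  continuous_const_smul p := by
    refine (MulAction.isOpenQuotientMap_quotientMk (Γ := translationGroup G)
      (T := Euc d)).isQuotientMap.continuous_iff.2 ?_
    exact continuous_quot_mk.comp (AffineIsometryEquiv.continuous
      ((surjInv (pointProj_surjective G) p : G) : EucGroup d))

/-- A lift `g` of `p` sends `v'` to `v` only up to an element of `Π`. Correcting `g` by that element
does not disturb the second factor, on which `Π` acts trivially. -/
theorem BTrans.exists_smul_mk_eq_iff {W : Type*} [MulAction (pointGroup G) W] (v v' : Euc d)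
    (w w' : W) :
    (∃ p : pointGroup G, p • (Quotient.mk _ v' : BTrans G) = Quotient.mk _ v ∧ p • w' = w) ↔
      ∃ g : G, g • v' = v ∧ pointProj G g • w' = w := by
  constructor
  · rintro ⟨p, h, hw⟩
    obtain ⟨g, rfl⟩ := pointProj_surjective G p
    rw [BTrans.smul_mk] at h
    obtain ⟨t, ht⟩ := Quotient.exact h
    have ht' : (t : G) • v = g • v' := ht
    have hπ : pointProj G (t : G) = 1 := t.2
    refine ⟨(t : G)⁻¹ * g, ?_, ?_⟩
    · rw [mul_smul, ← ht', inv_smul_smul]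
    · rw [map_mul, map_inv, hπ, inv_one, one_mul, hw]
  · rintro ⟨g, rfl, rfl⟩
    exact ⟨pointProj G g, BTrans.smul_mk G g v', rfl⟩

/-- The map `[(v, x)] ↦ [([v], x)]`, from `EΠ ×_G EP` to `BΠ ×_P EP`. -/
def borelHomeomorph (G : Subgroup (EucGroup d)) (EP : Type*) [TopologicalSpace EP]
    [MulAction (pointGroup G) EP] [ContinuousConstSMul (pointGroup G) EP] :
    BorelConstruction G (Euc d) (RestrictAlong (pointProj G) EP) ≃ₜ
      BorelConstruction (pointGroup G) (BTrans G) EP :=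
  OrbitSpace.homeomorph (A := Euc d × RestrictAlong (pointProj G) EP) (C := BTrans G × EP)
    (Prod.map (Quotient.mk _) id)
    (MulAction.isOpenQuotientMap_quotientMk.prodMap (.id (X := EP))) (by
      rintro ⟨v, x⟩ ⟨v', x'⟩
      have := BTrans.exists_smul_mk_eq_iff (G := G) (W := EP) v v' x x'
      simp only [Prod.ext_iff]
      exact this)

/-- `h_G^φ(pt)`, computed from `EΠ × EP`, is `h_P^φ(BΠ)`, since the defining pairs are homeomorphic. -/
theorem nonempty_twistedCohomology_point_equiv (F : OmegaSpectrum.{v}) (n : ℤ) {φ : G →* ℤˣ}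
    {ψ : pointGroup G →* ℤˣ} (hψ : ∀ g, ψ (pointProj G g) = φ g) (EP : Type*) [TopologicalSpace EP]
    [MulAction (pointGroup G) EP] [ContinuousConstSMul (pointGroup G) EP] :
    Nonempty (TwistedCohomology F φ n (Euc d × RestrictAlong (pointProj G) EP) PUnit.{1} ∅ ≃+
      TwistedCohomology F ψ n EP (BTrans G) ∅) := by
  -- `e₁` and `e₂` only reorder factors, so that the quotient map `q` concerns the factor `ℝ^d`
  -- alone.
  let e₁ : (Euc d × RestrictAlong (pointProj G) EP) × PUnit.{1} × TwistedInterval φ ≃ₜ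
      Euc d × (EP × unitInterval) :=
    { toFun := fun q => (q.1.1, (q.1.2, q.2.2))
      invFun := fun q => ((q.1, q.2.1), (PUnit.unit, q.2.2))
      left_inv := fun _ => rfl
      right_inv := fun _ => rfl
      continuous_toFun := (continuous_fst.comp continuous_fst).prodMk
        ((continuous_snd.comp continuous_fst).prodMk (continuous_snd.comp continuous_snd))
      continuous_invFun := (continuous_fst.prodMk (continuous_fst.comp continuous_snd)).prodMk
        (continuous_const.prodMk (continuous_snd.comp continuous_snd)) }
  let e₂ : BTrans G × (EP × unitInterval) ≃ₜ EP × BTrans G × TwistedInterval ψ :=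
    { toFun := fun q => (q.2.1, (q.1, q.2.2))
      invFun := fun q => (q.2.1, (q.1, q.2.2))
      left_inv := fun _ => rfl
      right_inv := fun _ => rfl
      continuous_toFun := (continuous_fst.comp continuous_snd).prodMk
        (continuous_fst.prodMk (continuous_snd.comp continuous_snd))
      continuous_invFun := (continuous_fst.comp continuous_snd).prodMk
        (continuous_fst.prodMk (continuous_snd.comp continuous_snd)) }
  let q : Euc d × (EP × unitInterval) → BTrans G × (EP × unitInterval) :=
    Prod.map (Quotient.mk _) id
  have hq : IsOpenQuotientMap q := MulAction.isOpenQuotientMap_quotientMk.prodMap .id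
  -- The two twisted intervals are the same space, and their actions agree along `π` because `ψ ∘ π
  -- = φ`.
  let ι : TwistedInterval φ → TwistedInterval ψ := fun t => t
  have hI : ∀ (g : G) t, ι (g • t) = pointProj G g • ι t := fun g t => Subtype.ext (by
    refine Eq.trans ?_ (TwistedInterval.smul_coe ψ _ _).symm
    rw [hψ]
    rfl)
  have hq' : IsOpenQuotientMap (e₂ ∘ q ∘ e₁) :=
    e₂.isOpenQuotientMap.comp (hq.comp e₁.isOpenQuotientMap)
  refine ⟨(PairHomotopyEquiv.ofHomeomorph (OrbitSpace.homeomorph (e₂ ∘ q ∘ e₁) hq' ?_)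
    (OrbitSpace.homeomorph_mem_iff _ _ _ ?_)).cohomologyEquiv F (n + 1)⟩
  · rintro ⟨⟨v, x⟩, ⟨-, t⟩⟩ ⟨⟨v', x'⟩, ⟨-, t'⟩⟩
    have key := BTrans.exists_smul_mk_eq_iff (G := G) (W := EP × TwistedInterval ψ) v v'
      (x, ι t) (x', ι t')
    constructor
    · rintro ⟨p, hp⟩
      obtain ⟨g, hv, hw⟩ := key.1 ⟨p, congrArg (fun c => c.2.1) hp,
        Prod.ext (congrArg (fun c => c.1) hp) (congrArg (fun c => c.2.2) hp)⟩
      exact ⟨g, Prod.ext (Prod.ext hv (congrArg Prod.fst hw))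
        (Prod.ext rfl ((hI g t').trans (congrArg Prod.snd hw)))⟩
    · rintro ⟨g, hg⟩
      obtain ⟨p, hv, hw⟩ := key.2 ⟨g, congrArg (fun c => c.1.1) hg,
        Prod.ext (congrArg (fun c => c.1.2) hg)
          ((hI g t').symm.trans (congrArg (fun c => c.2.2) hg))⟩
      exact ⟨p, Prod.ext (congrArg (fun c => c.1) hw)
        (Prod.ext hv (congrArg (fun c => c.2) hw))⟩
  · exact fun a => or_congr Iff.rfl Iff.rfl

/-- `h_G^φ(pt)`, computed from `E × X`, is `h_G^φ(X)`, since the defining pairs are homeomorphic. -/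
theorem nonempty_twistedCohomology_prod_equiv (F : OmegaSpectrum.{v}) (n : ℤ) {H : Type*} [Group H]
    (φ : H →* ℤˣ) (E X : Type*) [TopologicalSpace E] [MulAction H E] [TopologicalSpace X]
    [MulAction H X] [ContinuousConstSMul H E] [ContinuousConstSMul H X] :
    Nonempty (TwistedCohomology F φ n (E × X) PUnit.{1} ∅ ≃+ TwistedCohomology F φ n E X ∅) := by
  let e₁ : (E × X) × PUnit.{1} × TwistedInterval φ ≃ₜ E × X × TwistedInterval φ :=
    { toFun := fun q => (q.1.1, (q.1.2, q.2.2))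
      invFun := fun q => ((q.1, q.2.1), (PUnit.unit, q.2.2))
      left_inv := fun _ => rfl
      right_inv := fun _ => rfl
      continuous_toFun := by fun_prop
      continuous_invFun := by fun_prop }
  exact ⟨(PairHomotopyEquiv.ofHomeomorph (OrbitSpace.homeomorph e₁ e₁.isOpenQuotientMap
    fun a b => exists_congr fun g => e₁.injective.eq_iff (a := g • b) (b := a))
    (OrbitSpace.homeomorph_mem_iff _ _ _ fun a => or_congr Iff.rfl Iff.rfl)).cohomologyEquiv
      F (n + 1)⟩

end SpaceGroup

end

/-! ### The comparison theorem for space groups -/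

theorem mainTheorem10 {d : ℕ} (G : Subgroup (EucGroup d)) (hG : IsSpaceGroup G)
    (φint : G →* ℤˣ) (hφ : ∀ t ∈ translationGroup G, φint t = 1)
    {EG : Type u} [TopologicalSpace EG] [MulAction G EG] (hEG : IsUniversalSpace G EG)
    {EP : Type*} [TopologicalSpace EP] [MulAction (pointGroup G) EP]
    (hEP : IsUniversalSpace (pointGroup G) EP) :
    -- `ℝ^d` is a model of `EΠ`, and `EΠ × EP` is a model of `EG`
    IsUniversalSpace (translationGroup G) (Euc d) ∧
    IsUniversalSpace G (Euc d × RestrictAlong (pointProj G) EP) ∧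
    -- `EΠ ×_G EP` is the same space as `BΠ ×_P EP`
    (∃ e : BorelConstruction G (Euc d) (RestrictAlong (pointProj G) EP) ≃ₜ
        BorelConstruction (pointGroup G) (BTrans G) EP,
      ∀ (v : Euc d) (x : EP), e (Quotient.mk _ (v, x)) = Quotient.mk _ (Quotient.mk _ v, x)) ∧
    -- `BG` is homotopy equivalent to `BΠ ×_P EP`
    Nonempty (ContinuousMap.HomotopyEquiv (OrbitSpace G EG)
      (BorelConstruction (pointGroup G) (BTrans G) EP)) ∧
    ∀ F : OmegaSpectrum.{v},
      (∀ n : ℤ,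
        Nonempty (TwistedCohomology F (symmetrySign φint) n EG PUnit.{1} ∅ ≃+
          TwistedCohomology F (pointSign φint hφ) n EP (BTrans G) ∅) ∧
        Nonempty (TwistedCohomology F (symmetrySign φint) n EG PUnit.{1} ∅ ≃+
          TwistedCohomology F (symmetrySign φint) n EG (Euc d) ∅)) ∧
      ∀ SPT : ℕ → CategoryTheory.Functor SymmetryPairᵒᵖ AddCommGrpCat.{w},
        GeneralizedCohomologyHypothesis.{u, v, w} SPT F →
        Nonempty ((SPT d).obj (.op (SymmetryPair.of G (symmetrySign φint))) ≃+
          TwistedCohomology F (symmetrySign φint) d EG PUnit.{1} ∅) ∧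
        Nonempty ((SPT d).obj (.op (SymmetryPair.of G (symmetrySign φint))) ≃+
          TwistedCohomology F (pointSign φint hφ) d EP (BTrans G) ∅) ∧
        Nonempty ((SPT d).obj (.op (SymmetryPair.of G (symmetrySign φint))) ≃+
          TwistedCohomology F (symmetrySign φint) d EG (Euc d) ∅) := by
  have := hEP.continuous_smul
  have := hEG.continuous_smul
  have hprod := hG.isUniversalSpace_prod hEP
  have hpoint : ∀ (F : OmegaSpectrum.{v}) (n : ℤ),
      Nonempty (TwistedCohomology F (symmetrySign φint) n EG PUnit.{1} ∅ ≃+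
        TwistedCohomology F (pointSign φint hφ) n EP (BTrans G) ∅) := fun F n => by
    -- The given model is exchanged for `ℝ^d × EP`; the degree is `n + 1` because of the shift in
    -- the definition of twisted cohomology.
    obtain ⟨e₁⟩ := hEG.nonempty_equivariantCohomology_equiv hprod F (n + 1)
      (PUnit.{1} × TwistedInterval (symmetrySign φint))
      {q | q.1 ∈ (∅ : Set PUnit.{1}) ∨ q.2 ∈ TwistedInterval.boundary (symmetrySign φint)}
    obtain ⟨e₂⟩ := nonempty_twistedCohomology_point_equiv F n (pointSign_pointProj φint hφ) EP
    exact ⟨e₁.trans e₂⟩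
  have hspace : ∀ (F : OmegaSpectrum.{v}) (n : ℤ),
      Nonempty (TwistedCohomology F (symmetrySign φint) n EG PUnit.{1} ∅ ≃+
        TwistedCohomology F (symmetrySign φint) n EG (Euc d) ∅) := fun F n => by
    -- Here the model is exchanged for `EG × ℝ^d`, whose second factor is then moved from the model
    -- to the coefficient space.
    obtain ⟨e₁⟩ := hEG.nonempty_equivariantCohomology_equiv (hEG.prod (E₂ := Euc d)) F (n + 1)
      (PUnit.{1} × TwistedInterval (symmetrySign φint))
      {q | q.1 ∈ (∅ : Set PUnit.{1}) ∨ q.2 ∈ TwistedInterval.boundary (symmetrySign φint)}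
    obtain ⟨e₂⟩ := nonempty_twistedCohomology_prod_equiv F n (symmetrySign φint) EG (Euc d)
    exact ⟨e₁.trans e₂⟩
  refine ⟨hG.isUniversalSpace_translationGroup, hprod, ⟨borelHomeomorph G EP, fun _ _ => rfl⟩, ?_,
    fun F => ⟨fun n => ⟨hpoint F n, hspace F n⟩, fun SPT hSPT => ?_⟩⟩
  · obtain ⟨e⟩ := hEG.nonempty_homotopyEquiv hprod
    exact ⟨e.trans (borelHomeomorph G EP).toHomotopyEquiv⟩
  · obtain ⟨Θ, -⟩ := hSPT d
    have e₁ : (SPT d).obj (.op (SymmetryPair.of G (symmetrySign φint))) ≃+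
        TwistedCohomology F (symmetrySign φint) d EG PUnit.{1} ∅ :=
      let : MulAction (SymmetryPair.of G (symmetrySign φint)).left EG :=
        inferInstanceAs (MulAction G EG)
      Θ (SymmetryPair.of G (symmetrySign φint)) EG hEG
    obtain ⟨e₂⟩ := hpoint F d
    obtain ⟨e₃⟩ := hspace F d
    exact ⟨⟨e₁⟩, ⟨e₁.trans e₂⟩, ⟨e₁.trans e₃⟩⟩
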